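/- Let $S=[0,R]$ with $R>0$. Let $\eta:S\to[0,1]$ be a measurable regression function, $\eta(x)=\Pr(Y=+\mid X=x)$, with threshold $t\in S$: $\eta(t)=1/2$, $\eta>1/2$ on one side of $t$ and $\eta<1/2$ on the other, the side of the label $+$ being known. A query at $x\in S$ returns an independent label that is $+$ with probability $\eta(x)$. For $x\in S$ the excess risk of the threshold classifier at $x$ is $\mathcal R(x)-\mathcal R(t)=\int_{x\wedge t}^{x\vee t}|2\eta(z)-1|\,dz$. The function $\eta$ satisfies the Tsybakov noise condition (TNC) with parameters $k\ge 2$, $M>\mu>0$, $\epsilon_0>0$ if $$\mu|x-t|^{k-1}\le|\eta(x)-1/2|\le M|x-t|^{k-1}\quad\text{for all }x\in S\text{ with }|\eta(x)-1/2|\le\epsilon_0 .$$ Write $B(x,r)=[x-r,x+r]$. An optimal passive learning procedure $P$ with confidence factor $\delta\mapsto C_\delta$, where $C_\delta>\sqrt2$ for $0<\delta<1$ and $C_\delta=O(\sqrt{\log(1/\delta)})$ as $\delta\to0$, is a measurable, possibly randomized rule that, given $x\in S$, $r>0$, $N\ge1$ and $N$ labelled points drawn independently and uniformly from $S\cap B(x,r)$,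 outputs a point $P(x,r,N)\in S\cap B(x,r)$ such that, for every $\eta$ with a threshold as above (no noise condition is assumed) and every $\delta\in(0,1)$, with probability at least $1-\delta$ $$\mathcal R(P(x,r,N))-\min_{y\in S\cap B(x,r)}\mathcal R(y)\le\frac{C_\delta\, r}{\sqrt N}.$$ Algorithm 1 has input $R$, a query budget $T$, a confidence $\delta\in(0,1)$, an optimal passive learning procedure $P$ with confidence factor $C$, and any starting point $x_0\in S$; it does not know $k,\mu,M,\epsilon_0$. With $\log$ the binary logarithm, put $\tilde\delta=2\delta/\log T$, $E=\Big\lfloor\log\sqrt{2T/(C_{\tilde\delta}^2\log T)}\Big\rfloor$, $N=\lfloor T/E\rfloor$ and $R_e=2^{-e+1}R$. For $e=1,\dots,E$ it sets $x_e=P(x_{e-1},R_e,N)$, with a fresh sample in every epoch, and it outputs $x_E$. Theorem. Optimal passive learning procedures exist. For every confidence factor $C$ as above, all $k\ge2$, $M>\mu>0$, $\epsilon_0>0$ and $\delta\in(0,1)$, there are constants $K,p,T_0$, depending only on these data, on $R$ and on the orientation, such that for all $T\ge T_0$: Algorithm 1 is well defined ($E\ge1$, $N\ge1$) and uses $EN\le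 T$ queries, and for every optimal passive learning procedure $P$ with confidence factor $C$, every $\eta$ with threshold $t$ satisfying the TNC with parameters $k,\mu,M,\epsilon_0$, and every $x_0\in S$, with probability at least $1-\delta$ $$\mathcal R(x_E)-\mathcal R(t)\le K(\log T)^p\,T^{-\frac{k}{2k-2}},$$ that is, $\mathcal R(x_E)-\mathcal R(t)=\tilde O\big(T^{-k/(2k-2)}\big)$. -/

import Mathlib

open MeasureTheory Set

noncomputable section

namespace ActiveThreshold

/-- `η` is a regression function `η(x) = Pr(Y = + | X = x)` on the domain `[0, R]` with
threshold `t`: it equals `1/2` at `t` and only there, is larger than `1/2` on one side of `t` and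
smaller on the other. The orientation `s` is `1` if the side of the label `+` is the right one
and `-1` if it is the left one. -/
structure IsThreshold (s R : ℝ) (η : ℝ → ℝ) (t : ℝ) : Prop where
  measurable : Measurable η
  prob : ∀ x ∈ Icc 0 R, η x ∈ Icc (0 : ℝ) 1
  mem : t ∈ Icc 0 R
  half : η t = 1 / 2
  right : ∀ x ∈ Icc 0 R, t < x → 0 < s * (η x - 1 / 2)
  left : ∀ x ∈ Icc 0 R, x < t → s * (η x - 1 / 2) < 0

/-- The two-sided Tsybakov noise condition with exponent `k` at the threshold `t`. -/
def TNC (R : ℝ) (η : ℝ → ℝ) (t k μ M ε₀ : ℝ) : Prop :=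
  ∀ x ∈ Icc 0 R, |η x - 1 / 2| ≤ ε₀ →
    μ * |x - t| ^ (k - 1) ≤ |η x - 1 / 2| ∧ |η x - 1 / 2| ≤ M * |x - t| ^ (k - 1)

/-- The excess classification risk `𝓡(x) - 𝓡(t)` of the threshold classifier at `x` over the
Bayes classifier at `t` (uniform marginal). -/
def excessRisk (η : ℝ → ℝ) (t x : ℝ) : ℝ :=
  ∫ z in (min x t)..(max x t), |2 * η z - 1|

/-- The search region `S ∩ B(x, r)`, where `S = [0, R]` and `B(x, r) = [x - r, x + r]`. -/
def region (R x r : ℝ) : Set ℝ := Icc 0 R ∩ Icc (x - r) (x + r)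

/-- A point of `S ∩ B(x, r)`; uniformly distributed there if `u` is uniform on `[0, 1]`. -/
def query (R x r : ℝ) (u : unitInterval) : ℝ :=
  max 0 (x - r) + (u : ℝ) * (min R (x + r) - max 0 (x - r))

/-- The label of the point `q` (`true` stands for `+`); it is `+` with probability `η q` if `v` is
uniform on `[0, 1]`. -/
def label (η : ℝ → ℝ) (q : ℝ) (v : unitInterval) : Bool := decide ((v : ℝ) ≤ η q)

/-- The randomness of one call of a passive procedure with `N` queries: for every query a uniform
variable for the point and one for its label, and one for the procedure's own coin tosses.
Under `volume` all of them are independent and uniform on `[0, 1]`. -/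
abbrev Seed (N : ℕ) : Type := (Fin N → unitInterval × unitInterval) × unitInterval

/-- The labelled sample: `N` independent uniform points of `S ∩ B(x, r)` and their labels. -/
def sample (R : ℝ) (η : ℝ → ℝ) (x r : ℝ) {N : ℕ} (z : Fin N → unitInterval × unitInterval) :
    Fin N → ℝ × Bool :=
  fun i => (query R x r (z i).1, label η (query R x r (z i).1) (z i).2)

/-- A (possibly randomized) passive procedure: from a centre, a radius, the number `N` of queries,
a labelled sample of size `N` and internal randomness it computes a point. -/
abbrev PassiveProcedure : Type := ℝ → ℝ → (N : ℕ) → (Fin N → ℝ × Bool) → unitInterval → ℝ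

/-- The output of the call `P(x, r, N)` when labels are drawn according to `η`. -/
def PassiveProcedure.call (P : PassiveProcedure) (R : ℝ) (η : ℝ → ℝ) (x r : ℝ) {N : ℕ}
    (z : Seed N) : ℝ :=
  P x r N (sample R η x r z.1) z.2

/-- Admissible confidence factors `δ ↦ C_δ`: `C_δ > √2`, and `C_δ² = O(log (1/δ))` as `δ → 0`. -/
def IsConfidenceFactor (C : ℝ → ℝ) : Prop :=
  (∀ δ ∈ Ioo (0 : ℝ) 1, Real.sqrt 2 < C δ) ∧
    C =O[nhdsWithin 0 (Ioi 0)] (fun δ => Real.sqrt (Real.log (1 / δ)))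

/-- `P` is an optimal passive learning procedure on `[0, R]` (for thresholds of orientation `s`)
with confidence factor `C`: it outputs a point of `S ∩ B(x, r)` and, for every regression function
with a threshold, with probability at least `1 - δ` the risk of its output exceeds that of any
given competitor (in particular of the risk minimizer) in `S ∩ B(x, r)` by at most
`C_δ r / √N`. -/
structure IsOptimalPassive (s R : ℝ) (C : ℝ → ℝ) (P : PassiveProcedure) : Prop where
  measurable : ∀ (r : ℝ) (N : ℕ),
    Measurable (fun p : ℝ × (Fin N → ℝ × Bool) × unitInterval => P p.1 r N p.2.1 p.2.2)
  mem_region : ∀ x ∈ Icc 0 R, ∀ r > 0, ∀ (N : ℕ) (D : Fin N → ℝ × Bool) (w : unitInterval),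
    P x r N D w ∈ region R x r
  risk_le : ∀ (η : ℝ → ℝ) (t : ℝ), IsThreshold s R η t →
    ∀ x ∈ Icc 0 R, ∀ r > 0, ∀ N : ℕ, 1 ≤ N → ∀ δ ∈ Ioo (0 : ℝ) 1, ∀ y ∈ region R x r,
      ENNReal.ofReal (1 - δ) ≤
        volume {z : Seed N |
          excessRisk η t (P.call R η x r z) - excessRisk η t y ≤ C δ * r / Real.sqrt N}

/-- The confidence level `δ̃ = 2 δ / log T` of a single epoch (binary logarithm). -/
def epochConfidence (T : ℕ) (δ : ℝ) : ℝ := 2 * δ / Real.logb 2 T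

/-- The number of epochs `E = log √(2 T / (C_δ̃² log T))`, rounded down. -/
def numEpochs (C : ℝ → ℝ) (T : ℕ) (δ : ℝ) : ℕ :=
  ⌊Real.logb 2 (Real.sqrt (2 * T / (C (epochConfidence T δ) ^ 2 * Real.logb 2 T)))⌋₊

/-- The number of queries per epoch `N = T / E`, rounded down. -/
def epochQueries (C : ℝ → ℝ) (T : ℕ) (δ : ℝ) : ℕ := T / numEpochs C T δ

/-- The iterates of the adaptive learner started at `x₀`: `epochs e ω` is `x_e`, obtained by
calling `P(x_{e-1}, R_e, N)` with fresh randomness, where `R_e = 2^{-e+1} R`. -/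
def epochs (R : ℝ) (η : ℝ → ℝ) (P : PassiveProcedure) (N : ℕ) (x₀ : ℝ) :
    (e : ℕ) → (Fin e → Seed N) → ℝ
  | 0, _ => x₀
  | e + 1, ω =>
      P.call R η (epochs R η P N x₀ e (fun i => ω i.castSucc)) (R / 2 ^ e) (ω (Fin.last e))

/-- The output `x_E` of the adaptive threshold learner with oracle budget `T` and confidence
`δ`. -/
def adaptiveLearner (R : ℝ) (η : ℝ → ℝ) (C : ℝ → ℝ) (P : PassiveProcedure) (T : ℕ) (δ x₀ : ℝ)
    (ω : Fin (numEpochs C T δ) → Seed (epochQueries C T δ)) : ℝ :=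
  epochs R η P (epochQueries C T δ) x₀ (numEpochs C T δ) ω

end ActiveThreshold

end

/-!
As long as the threshold `t` lies in the search region, a call of `P` of radius `r` returns a
point of excess risk at most `a * r`, where `a = C_δ̃ / √N`. Excess risk grows like the `k`-th power
of the distance to `t`, so `t` stays in the next region, of half the radius, unless `r` is at most
some `ρ` of order `a ^ (1 / (k - 1))`. If `t` is lost at such a radius, every later call still
competes with its own centre, so the losses of all remaining epochs add up to at most `2 * a * ρ`,
which is of order `a ^ (k / (k - 1))`.

Empirical risk minimization is an optimal passive procedure. The empirical excess risk of a
threshold over the projection `p` of `t` to the region is a sum of independent terms with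
nonnegative drift over an initial segment of the sample, ordered by the distance to `p`. So Ville's
inequality for an exponential supermartingale bounds all thresholds of large risk at once, with no
logarithmic loss.
-/

namespace ActiveThreshold

/-! ### The excess risk -/

section ExcessRisk

variable {η : ℝ → ℝ} {p q x y : ℝ}

theorem excessRisk_eq_setIntegral (η : ℝ → ℝ) (p x : ℝ) :
    excessRisk η p x = ∫ z in uIoc p x, |2 * η z - 1| := by
  rw [uIoc_comm]
  exact intervalIntegral.integral_of_le min_le_max

theorem excessRisk_eq_abs (η : ℝ → ℝ) (p x : ℝ) :
    excessRisk η p x = |(∫ z in p..x, |2 * η z - 1|)| := by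
  rw [intervalIntegral.abs_intervalIntegral_eq, excessRisk_eq_setIntegral,
    abs_of_nonneg (integral_nonneg fun _ => abs_nonneg _)]

theorem excessRisk_self (η : ℝ → ℝ) (p : ℝ) : excessRisk η p p = 0 := by
  simp [excessRisk]

theorem measurable_excessRisk (hη : Measurable η) (p : ℝ) : Measurable (excessRisk η p) := by
  have hset : MeasurableSet {w : ℝ × ℝ | w.2 ∈ uIoc p w.1} := by
    have hlt : MeasurableSet {w : ℝ × ℝ | min p w.1 < w.2} :=
      measurableSet_lt (by fun_prop) (by fun_prop)
    exact hlt.inter (measurableSet_le (f := Prod.snd) (g := fun w : ℝ × ℝ => max p w.1)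
      (by fun_prop) (by fun_prop))
  have hind : Measurable fun w : ℝ × ℝ => (uIoc p w.1).indicator (fun z => |2 * η z - 1|) w.2 :=
    Measurable.indicator (f := fun w : ℝ × ℝ => |2 * η w.2 - 1|) (by fun_prop) hset
  have heq : excessRisk η p = fun x => ∫ z, (uIoc p x).indicator (fun z => |2 * η z - 1|) z := by
    ext x
    rw [excessRisk_eq_setIntegral, integral_indicator measurableSet_uIoc]
  rw [heq]
  exact (StronglyMeasurable.integral_prod_right' hind.stronglyMeasurable).measurable

section IntegrableOn

variable {S : Set ℝ} (hη : IntegrableOn (fun z => |2 * η z - 1|) S)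

include hη

theorem excessRisk_mono (hS : uIcc p x ⊆ S) (hy : y ∈ uIcc p x) :
    excessRisk η p y ≤ excessRisk η p x := by
  rw [excessRisk_eq_setIntegral, excessRisk_eq_setIntegral]
  refine setIntegral_mono_set (hη.mono_set (uIoc_subset_uIcc.trans hS))
    (ae_of_all _ fun _ => abs_nonneg _) (LE.le.eventuallyLE ?_)
  exact Ioc_subset_Ioc (le_inf inf_le_left hy.1) (sup_le le_sup_left hy.2)

theorem excessRisk_triangle (hpq : uIcc p q ⊆ S) (hqx : uIcc q x ⊆ S) :
    excessRisk η p x ≤ excessRisk η p q + excessRisk η q x := by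
  simp only [excessRisk_eq_abs]
  rw [← intervalIntegral.integral_add_adjacent_intervals
    (hη.mono_set hpq).intervalIntegrable (hη.mono_set hqx).intervalIntegrable]
  exact abs_add_le _ _

theorem excessRisk_sub_le (hp : p ∈ uIcc q y) (hy : uIcc q y ⊆ S) (hx : uIcc p x ⊆ S) :
    excessRisk η q x - excessRisk η q y ≤ excessRisk η p x := by
  have htri := excessRisk_triangle hη ((uIcc_subset_uIcc_left hp).trans hy) hx
  have hmono := excessRisk_mono hη hy hp
  linarith

theorem continuousOn_excessRisk (hS : uIcc p x ⊆ S) : ContinuousOn (excessRisk η p) (uIcc p x) := by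
  simp only [funext (excessRisk_eq_abs η p)]
  exact (intervalIntegral.continuousOn_primitive_interval'
    (hη.mono_set hS).intervalIntegrable left_mem_uIcc).abs

end IntegrableOn

theorem IsThreshold.integrableOn {s R t : ℝ} (h : IsThreshold s R η t) :
    IntegrableOn (fun z => |2 * η z - 1|) (Icc 0 R) := by
  have := h.measurable
  refine Measure.integrableOn_of_bounded (M := 1) (by simp)
    (Measurable.aestronglyMeasurable (by fun_prop)) ?_
  refine (ae_restrict_iff' measurableSet_Icc).2 (ae_of_all _ fun x hx => ?_)
  obtain ⟨h0, h1⟩ := h.prob x hx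
  rw [Real.norm_eq_abs, abs_abs, abs_le]
  constructor <;> linarith

end ExcessRisk

/-! ### From the noise condition to the growth of the excess risk -/

/-- The excess risk grows at least like the `k`-th power of the distance to the threshold `t`.
This is all that the rate requires of the noise. -/
def RiskGrowth (R : ℝ) (η : ℝ → ℝ) (t k c : ℝ) : Prop :=
  ∀ x ∈ Icc 0 R, c * |x - t| ^ k ≤ excessRisk η t x

theorem integral_abs_sub_rpow {p : ℝ} (hp : -1 < p) (t x : ℝ) :
    ∫ z in uIoc t x, |z - t| ^ p = |x - t| ^ (p + 1) / (p + 1) := by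
  have hpos : ∀ y : ℝ, 0 ≤ y → ∫ z in (0 : ℝ)..y, |z| ^ p = y ^ (p + 1) / (p + 1) := by
    intro y hy
    have habs : ∫ z in (0 : ℝ)..y, |z| ^ p = ∫ z in (0 : ℝ)..y, z ^ p := by
      refine intervalIntegral.integral_congr fun z hz => ?_
      rw [uIcc_of_le hy] at hz
      simp only [abs_of_nonneg hz.1]
    rw [habs, integral_rpow (Or.inl hp), Real.zero_rpow (by linarith), sub_zero]
  rcases le_total t x with h | h
  · rw [uIoc_of_le h, ← intervalIntegral.integral_of_le h,
      intervalIntegral.integral_comp_sub_right (fun z => |z| ^ p) t, sub_self,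
      hpos _ (sub_nonneg.2 h), abs_of_nonneg (sub_nonneg.2 h)]
  · rw [uIoc_of_ge h, ← intervalIntegral.integral_of_le h]
    simp only [abs_sub_comm _ t]
    rw [intervalIntegral.integral_comp_sub_left (fun z => |z| ^ p) t, sub_self,
      hpos _ (sub_nonneg.2 h), abs_of_nonneg (sub_nonneg.2 h)]

section Noise

variable {R k μ M ε₀ t : ℝ} {η : ℝ → ℝ}

theorem TNC.lower_bound (h : TNC R η t k μ M ε₀) (hR : 0 < R) (hk : 1 ≤ k) (hε : 0 ≤ ε₀)
    (ht : t ∈ Icc 0 R) {x : ℝ} (hx : x ∈ Icc 0 R) :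
    min μ (ε₀ / R ^ (k - 1)) * |x - t| ^ (k - 1) ≤ |η x - 1 / 2| := by
  have hpow : 0 ≤ |x - t| ^ (k - 1) := by positivity
  rcases le_or_gt |η x - 1 / 2| ε₀ with hsmall | hlarge
  · exact (mul_le_mul_of_nonneg_right (min_le_left _ _) hpow).trans (h x hx hsmall).1
  · have hdist : |x - t| ≤ R := by simpa [Real.dist_eq] using Real.dist_le_of_mem_Icc hx ht
    have hmono : |x - t| ^ (k - 1) ≤ R ^ (k - 1) :=
      Real.rpow_le_rpow (abs_nonneg _) hdist (by linarith)
    refine (mul_le_mul_of_nonneg_right (min_le_right _ _) hpow).trans (le_trans ?_ hlarge.le)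
    rw [div_mul_eq_mul_div, div_le_iff₀ (by positivity)]
    gcongr

theorem TNC.riskGrowth {s : ℝ} (h : TNC R η t k μ M ε₀) (hη : IsThreshold s R η t) (hR : 0 < R)
    (hk : 1 ≤ k) (hε : 0 ≤ ε₀) :
    RiskGrowth R η t k (2 * min μ (ε₀ / R ^ (k - 1)) / k) := by
  intro x hx
  set c := min μ (ε₀ / R ^ (k - 1))
  have hsub : uIoc t x ⊆ Icc 0 R := uIoc_subset_uIcc.trans (uIcc_subset_Icc hη.mem hx)
  have hcont : Continuous fun z : ℝ => 2 * c * |z - t| ^ (k - 1) :=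
    continuous_const.mul ((continuous_id.sub continuous_const).abs.rpow_const
      fun _ => Or.inr (by linarith))
  calc 2 * c / k * |x - t| ^ k = ∫ z in uIoc t x, 2 * c * |z - t| ^ (k - 1) := by
        rw [integral_const_mul, integral_abs_sub_rpow (by linarith), sub_add_cancel]
        ring
    _ ≤ ∫ z in uIoc t x, |2 * η z - 1| := by
        refine setIntegral_mono_on (hcont.intervalIntegrable t x).def'
          (hη.integrableOn.mono_set hsub) measurableSet_uIoc fun z hz => ?_
        have hdouble : |2 * η z - 1| = 2 * |η z - 1 / 2| := by
          rw [← abs_two, ← abs_mul, abs_two]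
          ring_nf
        linarith [h.lower_bound hR hk hε hη.mem (hsub hz)]
    _ = excessRisk η t x := (excessRisk_eq_setIntegral η t x).symm

end Noise

/-! ### Measurability of the learner -/

section Measurability

variable {s R : ℝ} {η : ℝ → ℝ} {C : ℝ → ℝ} {P : PassiveProcedure} {N : ℕ}

theorem measurable_label (hη : Measurable η) :
    Measurable fun p : ℝ × unitInterval => label η p.1 p.2 := by
  refine measurable_to_bool ?_
  have hpre : (fun p : ℝ × unitInterval => label η p.1 p.2) ⁻¹' {true} =
      {p | (p.2 : ℝ) ≤ η p.1} := by
    ext p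
    simp [label]
  rw [hpre]
  exact measurableSet_le (by fun_prop) (by fun_prop)

theorem measurable_sample (hη : Measurable η) (r : ℝ) :
    Measurable fun p : ℝ × (Fin N → unitInterval × unitInterval) => sample R η p.1 r p.2 := by
  refine measurable_pi_lambda _ fun i => ?_
  have hquery : Measurable fun p : ℝ × (Fin N → unitInterval × unitInterval) =>
      query R p.1 r (p.2 i).1 := by
    unfold query
    fun_prop
  exact hquery.prodMk ((measurable_label hη).comp (hquery.prodMk (by fun_prop)))

theorem IsOptimalPassive.measurable_call (hP : IsOptimalPassive s R C P) (hη : Measurable η)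
    (r : ℝ) : Measurable fun p : ℝ × Seed N => P.call R η p.1 r p.2 := by
  have hsample : Measurable fun p : ℝ × Seed N => sample R η p.1 r p.2.1 :=
    (measurable_sample hη r).comp (measurable_fst.prodMk (measurable_fst.comp measurable_snd))
  exact (hP.measurable r N).comp (measurable_fst.prodMk (hsample.prodMk (by fun_prop)))

theorem IsOptimalPassive.measurable_epochs (hP : IsOptimalPassive s R C P) (hη : Measurable η)
    (x₀ : ℝ) (e : ℕ) : Measurable (epochs R η P N x₀ e) := by
  induction e with
  | zero => exact measurable_const
  | succ e ih =>
    exact (hP.measurable_call hη (R / 2 ^ e)).comp ((ih.comp (by fun_prop)).prodMk (by fun_prop))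

end Measurability

/-! ### The chain of epochs -/

theorem mul_le_measure_pi_succ {α : Type*} [MeasurableSpace α] (μ : Measure α) [SigmaFinite μ]
    {n : ℕ} {A : Set (Fin n → α)} (hA : MeasurableSet A) {B : Set (α × (Fin n → α))}
    (hB : MeasurableSet B) {c : ENNReal} (hc : ∀ ω ∈ A, c ≤ μ {z | (z, ω) ∈ B}) :
    c * Measure.pi (fun _ => μ) A ≤
      Measure.pi (fun _ : Fin (n + 1) => μ) {ω | (ω (Fin.last n), fun i => ω i.castSucc) ∈ B} := by
  have hpres := measurePreserving_piFinSuccAbove (fun _ : Fin (n + 1) => μ) (Fin.last n)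
  have hpre : {ω : Fin (n + 1) → α | (ω (Fin.last n), fun i => ω i.castSucc) ∈ B} =
      MeasurableEquiv.piFinSuccAbove (fun _ : Fin (n + 1) => α) (Fin.last n) ⁻¹' B := by
    ext ω
    simp [MeasurableEquiv.piFinSuccAbove, Fin.init_def]
  rw [hpre, hpres.measure_preimage hB.nullMeasurableSet, Measure.prod_apply_symm hB,
    ← setLIntegral_const]
  exact (setLIntegral_mono' hA hc).trans (setLIntegral_le_lintegral _ _)

section Epochs

variable {s R : ℝ} {η : ℝ → ℝ} {C : ℝ → ℝ} {P : PassiveProcedure} {N : ℕ} {x₀ δ : ℝ}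

theorem IsOptimalPassive.call_mem_Icc (hP : IsOptimalPassive s R C P) {x : ℝ} (hx : x ∈ Icc 0 R)
    {r : ℝ} (hr : 0 < r) (z : Seed N) : P.call R η x r z ∈ Icc 0 R :=
  (hP.mem_region x hx r hr N _ _).1

theorem IsOptimalPassive.epochs_mem_Icc (hP : IsOptimalPassive s R C P) (hR : 0 < R)
    (hx₀ : x₀ ∈ Icc 0 R) (e : ℕ) (ω : Fin e → Seed N) : epochs R η P N x₀ e ω ∈ Icc 0 R := by
  induction e with
  | zero => exact hx₀
  | succ e ih => exact hP.call_mem_Icc (ih _) (by positivity) _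

theorem IsOptimalPassive.epochs_invariant (hP : IsOptimalPassive s R C P) (hR : 0 < R)
    (hη : Measurable η) (hx₀ : x₀ ∈ Icc 0 R) (hδ : δ ∈ Icc (0 : ℝ) 1) {I : ℕ → Set ℝ}
    (hI : ∀ e, MeasurableSet (I e)) (h0 : x₀ ∈ I 0)
    (hstep : ∀ e, ∀ x ∈ Icc 0 R, x ∈ I e → ENNReal.ofReal (1 - δ) ≤
      volume {z : Seed N | P.call R η x (R / 2 ^ e) z ∈ I (e + 1)}) (e : ℕ) :
    ENNReal.ofReal (1 - e * δ) ≤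
      volume {ω : Fin e → Seed N | epochs R η P N x₀ e ω ∈ I e} := by
  induction e with
  | zero => simp [epochs, h0]
  | succ e ih =>
    have hcall : Measurable fun p : Seed N × (Fin e → Seed N) =>
        P.call R η (epochs R η P N x₀ e p.2) (R / 2 ^ e) p.1 :=
      (hP.measurable_call hη _).comp
        (((hP.measurable_epochs hη x₀ e).comp measurable_snd).prodMk measurable_fst)
    calc ENNReal.ofReal (1 - (e + 1 : ℕ) * δ) ≤ ENNReal.ofReal ((1 - δ) * (1 - e * δ)) := by
          refine ENNReal.ofReal_le_ofReal ?_
          push_cast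
          nlinarith [mul_nonneg (Nat.cast_nonneg (α := ℝ) e) (sq_nonneg δ)]
      _ = ENNReal.ofReal (1 - δ) * ENNReal.ofReal (1 - e * δ) :=
          ENNReal.ofReal_mul (by linarith [hδ.2])
      _ ≤ ENNReal.ofReal (1 - δ) * volume {ω : Fin e → Seed N | epochs R η P N x₀ e ω ∈ I e} := by
          gcongr
      _ ≤ _ := mul_le_measure_pi_succ volume (hP.measurable_epochs hη x₀ e (hI e))
          (hcall (hI (e + 1))) fun ω hω => hstep e _ (hP.epochs_mem_Icc hR hx₀ e ω) hω

variable {t a ρ : ℝ}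

/-- The invariant of the learner after `e` epochs. Either the threshold `t` is within reach of the
next epoch, whose radius is `R / 2 ^ e`, and the last call competed with it; or it was lost in an
epoch of radius at most `ρ`, and every epoch since, of radius `r`, has added at most `a * r` to the
excess risk. -/
def goodPoints (R : ℝ) (η : ℝ → ℝ) (t a ρ : ℝ) (e : ℕ) : Set ℝ :=
  {x | (|x - t| ≤ R / 2 ^ e ∧ (0 < e → excessRisk η t x ≤ 2 * a * (R / 2 ^ e))) ∨
    excessRisk η t x ≤ 2 * a * (ρ - R / 2 ^ e)}

theorem measurableSet_goodPoints (hη : Measurable η) (e : ℕ) :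
    MeasurableSet (goodPoints R η t a ρ e) := by
  have hrisk (b : ℝ) : MeasurableSet {x | excessRisk η t x ≤ b} :=
    measurableSet_le (measurable_excessRisk hη t) measurable_const
  have hnear : MeasurableSet {x : ℝ | |x - t| ≤ R / 2 ^ e} :=
    measurableSet_le (by fun_prop) (by fun_prop)
  exact (hnear.inter ((MeasurableSet.const (0 < e)).imp (hrisk _))).union (hrisk _)

theorem IsOptimalPassive.call_mem_goodPoints (hP : IsOptimalPassive s R C P) (hR : 0 < R)
    (hη : IsThreshold s R η t) (hN : 1 ≤ N) (hδ : δ ∈ Ioo (0 : ℝ) 1) (ha : 0 ≤ a)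
    (hCa : C δ / √N ≤ a)
    (hρ : ∀ r, ρ < r → ∀ x ∈ Icc 0 R, excessRisk η t x ≤ a * r → |x - t| ≤ r / 2)
    {e : ℕ} {x : ℝ} (hx : x ∈ Icc 0 R) (hxe : x ∈ goodPoints R η t a ρ e) :
    ENNReal.ofReal (1 - δ) ≤
      volume {z : Seed N | P.call R η x (R / 2 ^ e) z ∈ goodPoints R η t a ρ (e + 1)} := by
  have hhalf : R / 2 ^ (e + 1) = R / 2 ^ e / 2 := by rw [pow_succ, div_div]
  have hr : 0 < R / 2 ^ e := by positivity
  unfold goodPoints at hxe ⊢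
  simp only [mem_ofPred_eq, hhalf] at hxe ⊢
  generalize R / 2 ^ e = r at *
  have hcompete (y : ℝ) (hy : y ∈ region R x r) : ENNReal.ofReal (1 - δ) ≤
      volume {z : Seed N | excessRisk η t (P.call R η x r z) ≤ excessRisk η t y + a * r} := by
    refine (hP.risk_le η t hη x hx r hr N hN δ hδ y hy).trans (measure_mono fun z hz => ?_)
    have hbound : C δ * r / √N ≤ a * r := by
      rw [mul_div_right_comm]
      gcongr
    exact sub_le_iff_le_add'.1 (hz.trans hbound)
  by_cases hnear : |x - t| ≤ r
  · have ht : t ∈ region R x r := ⟨hη.mem, by constructor <;> linarith [abs_le.1 hnear]⟩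
    refine (hcompete t ht).trans (measure_mono fun z hz => ?_)
    rw [mem_ofPred_eq, excessRisk_self, zero_add] at hz
    rcases lt_or_ge ρ r with hρr | hρr
    · exact Or.inl ⟨hρ r hρr _ (hP.call_mem_Icc hx hr z) hz, fun _ => by linarith⟩
    · exact Or.inr (by nlinarith [mul_le_mul_of_nonneg_left hρr ha])
  · have hlost := hxe.resolve_left fun h => hnear h.1
    refine (hcompete x ⟨hx, by constructor <;> linarith⟩).trans (measure_mono fun z hz => ?_)
    rw [mem_ofPred_eq] at hz
    exact Or.inr (by linarith)

theorem IsOptimalPassive.epochs_risk_le (hP : IsOptimalPassive s R C P) (hR : 0 < R)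
    (hη : IsThreshold s R η t) (hN : 1 ≤ N) (hx₀ : x₀ ∈ Icc 0 R) (hδ : δ ∈ Ioo (0 : ℝ) 1)
    (ha : 0 ≤ a) (hCa : C δ / √N ≤ a)
    (hρ : ∀ r, ρ < r → ∀ x ∈ Icc 0 R, excessRisk η t x ≤ a * r → |x - t| ≤ r / 2)
    {e : ℕ} (he : 0 < e) :
    ENNReal.ofReal (1 - e * δ) ≤ volume {ω : Fin e → Seed N |
      excessRisk η t (epochs R η P N x₀ e ω) ≤ max (2 * a * (R / 2 ^ e)) (2 * a * ρ)} := by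
  have hstart : x₀ ∈ goodPoints R η t a ρ 0 :=
    Or.inl ⟨by simpa [Real.dist_eq] using Real.dist_le_of_mem_Icc hx₀ hη.mem, by simp⟩
  refine (hP.epochs_invariant hR hη.measurable hx₀ (Ioo_subset_Icc_self hδ)
    (measurableSet_goodPoints hη.measurable) hstart
    (fun e x hx hxe => hP.call_mem_goodPoints hR hη hN hδ ha hCa hρ hx hxe) e).trans
    (measure_mono fun ω hω => ?_)
  have hr : 0 ≤ a * (R / 2 ^ e) := by positivity
  rcases hω with ⟨-, htracked⟩ | hlost
  · exact (htracked he).trans (le_max_left _ _)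
  · exact (hlost.trans (by linarith)).trans (le_max_right _ _)

end Epochs

theorem RiskGrowth.abs_sub_le {R t k c a r x : ℝ} {η : ℝ → ℝ} (h : RiskGrowth R η t k c)
    (hk : 1 < k) (hc : 0 < c) (ha : 0 ≤ a) (hr : (2 ^ k * a / c) ^ (1 / (k - 1)) < r)
    (hx : x ∈ Icc 0 R) (hrisk : excessRisk η t x ≤ a * r) : |x - t| ≤ r / 2 := by
  have hr0 : 0 < r := lt_of_le_of_lt (by positivity) hr
  by_contra! hfar
  have hpow : 2 ^ k * a / c < r ^ (k - 1) := by
    rwa [one_div, Real.rpow_inv_lt_iff_of_pos (by positivity) hr0.le (by linarith)] at hr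
  have hball : c * (r / 2) ^ k ≤ a * r := by
    refine le_trans ?_ ((h x hx).trans hrisk)
    gcongr
  rw [Real.div_rpow hr0.le two_pos.le, ← mul_div_assoc, div_le_iff₀ (by positivity)] at hball
  rw [div_lt_iff₀ hc, Real.rpow_sub_one hr0.ne', div_mul_eq_mul_div, lt_div_iff₀ hr0] at hpow
  linarith

/-! ### The schedule for a large budget -/

/-- A bound for the precision `C_δ̃ / √N` of an epoch when `C_δ̃² ≤ D log T`. The last search radius
is of the same order, relative to `R`. -/
noncomputable def epochPrecision (D : ℝ) (T : ℕ) : ℝ := √D * Real.logb 2 T / √T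

/-- The budget `T` is large enough for the schedule of the learner to be meaningful, given a bound
`C_δ̃² ≤ D log T` on the confidence factor. -/
structure LargeBudget (C : ℝ → ℝ) (δ D : ℝ) (T : ℕ) : Prop where
  epochConfidence_mem : epochConfidence T δ ∈ Ioo (0 : ℝ) 1
  sqrt_two_lt : √2 < C (epochConfidence T δ)
  sq_le : C (epochConfidence T δ) ^ 2 ≤ D * Real.logb 2 T
  two_le_logb : 2 ≤ Real.logb 2 T
  two_mul_le : 2 * (D * Real.logb 2 T ^ 2) ≤ T

theorem tendsto_logb_two_natCast :
    Filter.Tendsto (fun T : ℕ => Real.logb 2 T) Filter.atTop Filter.atTop :=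
  (Real.tendsto_logb_atTop one_lt_two).comp tendsto_natCast_atTop_atTop

theorem tendsto_epochConfidence {δ : ℝ} (hδ : 0 < δ) :
    Filter.Tendsto (fun T : ℕ => epochConfidence T δ) Filter.atTop (nhdsWithin 0 (Ioi 0)) := by
  refine tendsto_nhdsWithin_iff.2 ⟨tendsto_logb_two_natCast.const_div_atTop _, ?_⟩
  filter_upwards [tendsto_logb_two_natCast.eventually_gt_atTop 0] with T hT
  exact div_pos (by linarith) hT

theorem IsConfidenceFactor.exists_sq_le {C : ℝ → ℝ} (hC : IsConfidenceFactor C) {δ : ℝ}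
    (hδ : 0 < δ) :
    ∃ D, ∀ᶠ T : ℕ in Filter.atTop, C (epochConfidence T δ) ^ 2 ≤ D * Real.logb 2 T := by
  obtain ⟨c, hc⟩ := hC.2.bound
  refine ⟨c ^ 2 / (2 * δ), ?_⟩
  filter_upwards [(tendsto_epochConfidence hδ).eventually hc,
    tendsto_logb_two_natCast.eventually_ge_atTop (2 * δ)] with T hT hℓ
  have hinv : 1 / epochConfidence T δ = Real.logb 2 T / (2 * δ) := one_div_div _ _
  rw [hinv, Real.norm_eq_abs, Real.norm_eq_abs] at hT
  generalize Real.logb 2 T = ℓ at *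
  have hlog : 0 ≤ Real.log (ℓ / (2 * δ)) := Real.log_nonneg ((one_le_div (by positivity)).2 hℓ)
  calc C (epochConfidence T δ) ^ 2 = |C (epochConfidence T δ)| ^ 2 := (sq_abs _).symm
    _ ≤ (c * |√(Real.log (ℓ / (2 * δ)))|) ^ 2 := by gcongr
    _ = c ^ 2 * Real.log (ℓ / (2 * δ)) := by rw [mul_pow, sq_abs, Real.sq_sqrt hlog]
    _ ≤ c ^ 2 * (ℓ / (2 * δ)) := by
        have hℓ0 : 0 < ℓ := by linarith
        gcongr
        exact Real.log_le_self (by positivity)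
    _ = c ^ 2 / (2 * δ) * ℓ := by ring

theorem eventually_mul_logb_sq_le (A : ℝ) :
    ∀ᶠ T : ℕ in Filter.atTop, A * Real.logb 2 T ^ 2 ≤ T := by
  have hlittle := (Real.isLittleO_pow_log_id_atTop (n := 2)).const_mul_left (A / Real.log 2 ^ 2)
  filter_upwards [tendsto_natCast_atTop_atTop.eventually (hlittle.bound one_pos)] with T hT
  refine le_trans (le_abs_self _) ?_
  simpa [Real.logb, div_pow, abs_div, div_mul_eq_mul_div, mul_div_assoc] using hT

theorem IsConfidenceFactor.exists_eventually_largeBudget {C : ℝ → ℝ} (hC : IsConfidenceFactor C)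
    {δ : ℝ} (hδ : 0 < δ) : ∃ D, ∀ᶠ T : ℕ in Filter.atTop, LargeBudget C δ D T := by
  obtain ⟨D, hD⟩ := hC.exists_sq_le hδ
  refine ⟨D, ?_⟩
  have hconf := (tendsto_epochConfidence hδ).eventually (Ioo_mem_nhdsGT one_pos)
  filter_upwards [hD, hconf, tendsto_logb_two_natCast.eventually_ge_atTop 2,
    eventually_mul_logb_sq_le (2 * D)] with T hDT hδT hℓ hT
  exact ⟨hδT, hC.1 _ hδT, hDT, hℓ, by rwa [← mul_assoc]⟩

namespace LargeBudget

variable {C : ℝ → ℝ} {δ D : ℝ} {T : ℕ} (h : LargeBudget C δ D T)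

include h

theorem logb_pos : 0 < Real.logb 2 T := two_pos.trans_le h.two_le_logb

theorem factor_pos : 0 < C (epochConfidence T δ) := (Real.sqrt_nonneg 2).trans_lt h.sqrt_two_lt

theorem two_lt_sq : 2 < C (epochConfidence T δ) ^ 2 := (Real.sqrt_lt' h.factor_pos).1 h.sqrt_two_lt

theorem const_pos : 0 < D :=
  pos_of_mul_pos_left ((two_pos.trans h.two_lt_sq).trans_le h.sq_le) h.logb_pos.le

theorem budget_pos : (0 : ℝ) < T := by
  have := h.const_pos
  have := h.logb_pos
  exact lt_of_lt_of_le (by positivity) h.two_mul_le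

theorem epochPrecision_pos : 0 < epochPrecision D T := by
  have := h.const_pos
  have := h.logb_pos
  have := h.budget_pos
  unfold epochPrecision
  positivity

theorem sqrt_div_eq : √(T / (D * Real.logb 2 T ^ 2)) = 1 / epochPrecision D T := by
  rw [epochPrecision, one_div_div, Real.sqrt_div' _ (by have := h.const_pos; positivity),
    Real.sqrt_mul h.const_pos.le, Real.sqrt_sq h.logb_pos.le]

theorem epochPrecision_le_one : epochPrecision D T ≤ 1 := by
  have hD := h.const_pos
  have hℓ := h.logb_pos
  have hone : 1 ≤ √(T / (D * Real.logb 2 T ^ 2)) := by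
    rw [Real.one_le_sqrt, one_le_div (by positivity)]
    linarith [h.two_mul_le, (by positivity : 0 ≤ D * Real.logb 2 T ^ 2)]
  rwa [h.sqrt_div_eq, one_le_div h.epochPrecision_pos] at hone

theorem two_le_sqrt : 2 ≤ √(2 * T / (C (epochConfidence T δ) ^ 2 * Real.logb 2 T)) := by
  have hC := h.factor_pos
  have hℓ := h.logb_pos
  refine Real.le_sqrt_of_sq_le ((le_div_iff₀ (by positivity)).2 ?_)
  linarith [h.two_mul_le, mul_le_mul_of_nonneg_right h.sq_le hℓ.le]

theorem numEpochs_pos : 0 < numEpochs C T δ := by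
  refine Nat.floor_pos.2 ((Real.le_logb_iff_rpow_le one_lt_two ?_).2 ?_)
  · linarith [h.two_le_sqrt]
  · simpa using h.two_le_sqrt

theorem numEpochs_le : (numEpochs C T δ : ℝ) ≤ Real.logb 2 T / 2 := by
  have hT := h.budget_pos
  have hlarge := h.two_le_sqrt
  refine (Nat.floor_le (Real.logb_nonneg one_lt_two (by linarith))).trans ?_
  calc Real.logb 2 (√(2 * T / (C (epochConfidence T δ) ^ 2 * Real.logb 2 T)))
      ≤ Real.logb 2 (√T) := by
        refine Real.logb_le_logb_of_le one_lt_two (by linarith) (Real.sqrt_le_sqrt ?_)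
        have hden : 2 * 2 ≤ C (epochConfidence T δ) ^ 2 * Real.logb 2 T :=
          mul_le_mul h.two_lt_sq.le h.two_le_logb two_pos.le (sq_nonneg _)
        exact div_le_of_le_mul₀ (by linarith) hT.le (by nlinarith)
    _ = Real.logb 2 T / 2 := by
        rw [Real.sqrt_eq_rpow, Real.logb_rpow_eq_mul_logb_of_pos hT, one_div_mul_eq_div]

theorem numEpochs_mul_epochConfidence_le : numEpochs C T δ * epochConfidence T δ ≤ δ := by
  refine (mul_le_mul_of_nonneg_right h.numEpochs_le h.epochConfidence_mem.1.le).trans_eq ?_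
  have := h.logb_pos.ne'
  unfold epochConfidence
  field_simp

theorem one_div_two_pow_numEpochs_le : 1 / 2 ^ numEpochs C T δ ≤ 2 * epochPrecision D T := by
  have hC := h.factor_pos
  have hℓ := h.logb_pos
  have hT := h.budget_pos
  have hlarge := h.two_le_sqrt
  have hfloor : √(2 * T / (C (epochConfidence T δ) ^ 2 * Real.logb 2 T)) <
      2 ^ (numEpochs C T δ + 1) := by
    have hlt : Real.logb 2 (√(2 * T / (C (epochConfidence T δ) ^ 2 * Real.logb 2 T))) <
        numEpochs C T δ + 1 := Nat.lt_floor_add_one _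
    rw [Real.logb_lt_iff_lt_rpow one_lt_two (by linarith)] at hlt
    exact_mod_cast hlt
  have hlower : 1 / epochPrecision D T ≤
      √(2 * T / (C (epochConfidence T δ) ^ 2 * Real.logb 2 T)) := by
    rw [← h.sqrt_div_eq]
    refine Real.sqrt_le_sqrt (div_le_div₀ (by positivity) (by linarith) (by positivity) ?_)
    linarith [mul_le_mul_of_nonneg_right h.sq_le hℓ.le]
  have hprod := (div_le_iff₀ h.epochPrecision_pos).1 (hlower.trans hfloor.le)
  rw [div_le_iff₀ (by positivity)]
  rw [pow_succ] at hprod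
  linarith

theorem numEpochs_le_budget : numEpochs C T δ ≤ T := by
  have hlog : Real.logb 2 T ≤ T := by
    have hbern : 1 + Real.logb 2 T * 1 ≤ (1 + 1) ^ Real.logb 2 T :=
      one_add_mul_self_le_rpow_one_add (by norm_num) (by linarith [h.two_le_logb])
    rw [one_add_one_eq_two, Real.rpow_logb two_pos (by norm_num) h.budget_pos] at hbern
    linarith
  have : (numEpochs C T δ : ℝ) ≤ T := by linarith [h.numEpochs_le, h.logb_pos]
  exact_mod_cast this

theorem epochQueries_pos : 0 < epochQueries C T δ :=
  Nat.div_pos h.numEpochs_le_budget h.numEpochs_pos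

theorem div_logb_le_epochQueries : T / Real.logb 2 T ≤ epochQueries C T δ := by
  have hround : T < (epochQueries C T δ + 1) * numEpochs C T δ :=
    (Nat.div_lt_iff_lt_mul h.numEpochs_pos).1 (Nat.lt_succ_self _)
  have hround' : (T : ℝ) < (epochQueries C T δ + 1) * numEpochs C T δ := by exact_mod_cast hround
  have hN : (1 : ℝ) ≤ epochQueries C T δ := by exact_mod_cast h.epochQueries_pos
  rw [div_le_iff₀ h.logb_pos]
  nlinarith [h.numEpochs_le, h.logb_pos]

theorem factor_div_sqrt_le : C (epochConfidence T δ) / √(epochQueries C T δ) ≤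
    epochPrecision D T := by
  have hℓ := h.logb_pos
  have hT := h.budget_pos
  calc C (epochConfidence T δ) / √(epochQueries C T δ)
      ≤ √(D * Real.logb 2 T) / √(T / Real.logb 2 T) :=
        div_le_div₀ (Real.sqrt_nonneg _) (Real.le_sqrt_of_sq_le h.sq_le) (by positivity)
          (Real.sqrt_le_sqrt h.div_logb_le_epochQueries)
    _ = epochPrecision D T := by
        rw [epochPrecision, Real.sqrt_mul h.const_pos.le, Real.sqrt_div hT.le,
          div_div_eq_mul_div, mul_assoc, Real.mul_self_sqrt hℓ.le]

end LargeBudget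

/-! ### The rate -/

theorem epochPrecision_rpow_le {D k : ℝ} {T : ℕ} (hℓ : 1 ≤ Real.logb 2 T) (hk : 2 ≤ k) :
    epochPrecision D T ^ (k / (k - 1)) ≤
      √D ^ (k / (k - 1)) * Real.logb 2 T ^ 2 * (T : ℝ) ^ (-(k / (2 * k - 2))) := by
  have hk1 : 0 < k - 1 := by linarith
  have hsqrt : √(T : ℝ) ^ (k / (k - 1)) = (T : ℝ) ^ (k / (2 * k - 2)) := by
    rw [Real.sqrt_eq_rpow, ← Real.rpow_mul T.cast_nonneg, one_div, inv_mul_eq_div, div_div,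
      sub_one_mul, mul_comm k 2]
  have hlog : Real.logb 2 T ^ (k / (k - 1)) ≤ Real.logb 2 T ^ 2 := by
    rw [← Real.rpow_natCast]
    refine Real.rpow_le_rpow_of_exponent_le hℓ ((div_le_iff₀ hk1).2 ?_)
    push_cast
    linarith
  rw [epochPrecision, Real.div_rpow (by positivity) (by positivity),
    Real.mul_rpow (by positivity) (by positivity), hsqrt, Real.rpow_neg T.cast_nonneg,
    div_eq_mul_inv]
  gcongr

theorem max_le_mul_rpow {R k c b : ℝ} {E : ℕ} (hR : 0 ≤ R) (hk : 2 ≤ k) (hc : 0 < c) (hb : 0 < b)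
    (hb1 : b ≤ 1) (hE : 1 / 2 ^ E ≤ 2 * b) :
    max (2 * b * (R / 2 ^ E)) (2 * b * (2 ^ k * b / c) ^ (1 / (k - 1))) ≤
      (4 * R + 2 * (2 ^ k / c) ^ (1 / (k - 1))) * b ^ (k / (k - 1)) := by
  have hk1 : 0 < k - 1 := by linarith
  have htracked : 2 * b * (R / 2 ^ E) ≤ 4 * R * b ^ (k / (k - 1)) := calc
    2 * b * (R / 2 ^ E) = 2 * b * R * (1 / 2 ^ E) := by ring
    _ ≤ 2 * b * R * (2 * b) := by gcongr
    _ = 4 * R * b ^ (2 : ℝ) := by rw [Real.rpow_two]; ring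
    _ ≤ 4 * R * b ^ (k / (k - 1)) := by
        gcongr 4 * R * ?_
        exact Real.rpow_le_rpow_of_exponent_ge hb hb1 ((div_le_iff₀ hk1).2 (by linarith))
  have hlost : 2 * b * (2 ^ k * b / c) ^ (1 / (k - 1)) =
      2 * (2 ^ k / c) ^ (1 / (k - 1)) * b ^ (k / (k - 1)) := by
    have hexp : k / (k - 1) = 1 + 1 / (k - 1) := by field_simp; ring
    rw [mul_div_right_comm, Real.mul_rpow (by positivity) hb.le, hexp, Real.rpow_add hb,
      Real.rpow_one]
    ring
  rw [hlost, add_mul]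
  refine max_le (htracked.trans (le_add_of_nonneg_right ?_)) (le_add_of_nonneg_left ?_) <;>
    positivity

theorem LargeBudget.adaptiveLearner_rate {R s δ D k c t x₀ : ℝ} {C : ℝ → ℝ} {T : ℕ}
    (h : LargeBudget C δ D T) (hR : 0 < R) (hk : 2 ≤ k) (hc : 0 < c) {P : PassiveProcedure}
    (hP : IsOptimalPassive s R C P) {η : ℝ → ℝ} (hη : IsThreshold s R η t)
    (hrisk : RiskGrowth R η t k c) (hx₀ : x₀ ∈ Icc 0 R) :
    ENNReal.ofReal (1 - δ) ≤
      volume {ω : Fin (numEpochs C T δ) → Seed (epochQueries C T δ) |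
        excessRisk η t (adaptiveLearner R η C P T δ x₀ ω) ≤
          (4 * R + 2 * (2 ^ k / c) ^ (1 / (k - 1))) * √D ^ (k / (k - 1)) *
            Real.logb 2 T ^ 2 * (T : ℝ) ^ (-(k / (2 * k - 2)))} := by
  have hb := h.epochPrecision_pos
  have hbound := (max_le_mul_rpow hR.le hk hc hb h.epochPrecision_le_one
    h.one_div_two_pow_numEpochs_le).trans
    (mul_le_mul_of_nonneg_left (epochPrecision_rpow_le (by linarith [h.two_le_logb]) hk)
      (by positivity))
  have hepochs := hP.epochs_risk_le hR hη h.epochQueries_pos hx₀ h.epochConfidence_mem hb.le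
    h.factor_div_sqrt_le
    (fun r hr x hx hxr => hrisk.abs_sub_le (by linarith) hc hb.le hr hx hxr) h.numEpochs_pos
  refine le_trans (ENNReal.ofReal_le_ofReal ?_) (hepochs.trans (measure_mono fun ω hω => ?_))
  · linarith [h.numEpochs_mul_epochConfidence_le]
  · refine (show excessRisk η t (adaptiveLearner R η C P T δ x₀ ω) ≤ _ from hω).trans ?_
    simpa only [mul_assoc] using hbound

/-! ### A maximal inequality over initial segments -/

/-- `S` is an initial segment of the ranking by `X`; indices of equal rank are in `S` together or
not at all. -/
def IsInitialSegment {ι γ : Type*} [LE γ] (X : ι → γ) (S : Finset ι) : Prop :=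
  ∀ i ∈ S, ∀ j, X j ≤ X i → j ∈ S

theorem IsInitialSegment.preimage {ι κ γ : Type*} [LE γ] {X : ι → γ} {S : Finset ι}
    (hS : IsInitialSegment X S) {f : κ → ι} (hf : InjOn f (f ⁻¹' S)) :
    IsInitialSegment (X ∘ f) (S.preimage f hf) := fun _ hi _ hj =>
  Finset.mem_preimage.2 (hS _ (Finset.mem_preimage.1 hi) _ hj)

theorem sum_eq_add_sum_preimage_succAbove {n : ℕ} {S : Finset (Fin (n + 1))} {p : Fin (n + 1)}
    (hp : p ∈ S) (f : Fin (n + 1) → ℝ) :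
    ∑ i ∈ S, f i =
      f p + ∑ j ∈ S.preimage p.succAbove Fin.succAbove_right_injective.injOn,
        f (p.succAbove j) := by
  have hite : ∀ {ι : Type} [Fintype ι] [DecidableEq ι] (A : Finset ι) (h : ι → ℝ),
      ∑ i ∈ A, h i = ∑ i, if i ∈ A then h i else 0 := fun A h => by
    rw [Finset.sum_ite_mem, Finset.univ_inter]
  rw [hite S, Fin.sum_univ_succAbove _ p, if_pos hp, hite (S.preimage _ _)]
  simp only [Finset.mem_preimage]

theorem exists_initialSegment_succAbove {γ : Type*} [LE γ] {n : ℕ} {X : Fin (n + 1) → γ}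
    {p : Fin (n + 1)} (hp : ∀ i, X p ≤ X i) {f : Fin (n + 1) → ℝ} {x : ℝ} (hx : 0 < x)
    (h : ∃ S : Finset (Fin (n + 1)), IsInitialSegment X S ∧ x ≤ ∑ i ∈ S, f i) :
    ∃ S : Finset (Fin n), IsInitialSegment (X ∘ p.succAbove) S ∧
      x - f p ≤ ∑ i ∈ S, f (p.succAbove i) := by
  obtain ⟨S, hS, hxS⟩ := h
  obtain ⟨i, hi⟩ : S.Nonempty := Finset.nonempty_of_sum_ne_zero (hx.trans_le hxS).ne'
  rw [sum_eq_add_sum_preimage_succAbove (hS i hi p (hp i))] at hxS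
  exact ⟨_, hS.preimage _, sub_le_iff_le_add'.2 hxS⟩

theorem measurableSet_exists_finset_le_sum {Ω ι : Type*} [MeasurableSpace Ω] [Finite ι]
    {p : Finset ι → Ω → Prop} (hp : ∀ S, MeasurableSet {ω | p S ω}) {x : Ω → ℝ}
    (hx : Measurable x) {g : ι → Ω → ℝ} (hg : ∀ i, Measurable (g i)) :
    MeasurableSet {ω | ∃ S : Finset ι, p S ω ∧ x ω ≤ ∑ i ∈ S, g i ω} := by
  simp only [ofPred_exists]
  exact MeasurableSet.iUnion fun S =>
    (hp S).inter (measurableSet_le hx (Finset.measurable_sum _ fun i _ => hg i))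

theorem measurableSet_isInitialSegment {Ω ι : Type*} [MeasurableSpace Ω] [Finite ι]
    {X : ι → Ω → ℝ} (hX : ∀ i, Measurable (X i)) (S : Finset ι) :
    MeasurableSet {ω | IsInitialSegment (fun i => X i ω) S} := by
  simp only [IsInitialSegment, ofPred_forall]
  exact MeasurableSet.iInter fun i => MeasurableSet.iInter fun _ => MeasurableSet.iInter fun j =>
    (measurableSet_le (hX j) (hX i)).imp (MeasurableSet.const _)

theorem mul_sum_indicator_sub_le_sum {α : Type*} {N : ℕ} {B : Set α} {u : Fin N → α} {h : α → ℝ}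
    (hh : ∀ u, 0 ≤ h u) {S : Finset (Fin N)} (hS : ∀ i, u i ∈ B → i ∈ S) {w : Fin N → ℝ}
    (hw : ∑ i ∈ S, w i ≤ 0) {l : ℝ} (hl : 0 ≤ l) :
    l * ∑ i, B.indicator h (u i) - N * (l ^ 2 / 2) ≤
      ∑ i ∈ S, (-l * w i - (-l * h (u i) + l ^ 2 / 2)) := by
  have hsum : ∑ i, B.indicator h (u i) ≤ ∑ i ∈ S, h (u i) := calc
    ∑ i, B.indicator h (u i) = ∑ i ∈ S, B.indicator h (u i) :=
      (Finset.sum_subset (Finset.subset_univ S) fun i _ hi =>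
        indicator_of_notMem (fun hB => hi (hS i hB)) _).symm
    _ ≤ ∑ i ∈ S, h (u i) :=
      Finset.sum_le_sum fun i _ => indicator_le_self' (fun _ _ => hh _) _
  have hcard : (S.card : ℝ) ≤ N := by exact_mod_cast card_finset_fin_le S
  rw [Finset.sum_sub_distrib, Finset.sum_add_distrib, ← Finset.mul_sum, ← Finset.mul_sum,
    Finset.sum_const, nsmul_eq_mul]
  linarith [mul_le_mul_of_nonneg_left hsum hl, mul_nonpos_of_nonneg_of_nonpos hl hw,
    mul_le_mul_of_nonneg_right hcard (by positivity : 0 ≤ l ^ 2 / 2)]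

section Maximal

variable {α β : Type*} [MeasurableSpace α] [MeasurableSpace β] {μ : Measure α} {ν : Measure β}
  [IsProbabilityMeasure μ] [IsProbabilityMeasure ν]

-- Ville's inequality by induction on `n`: a nonempty initial segment contains the lowest index,
-- and conditioning on its summand only shifts the level `x`.
theorem measure_exists_initialSegment_le_sum_le {γ : Type*} [LinearOrder γ] {n : ℕ} (X : Fin n → γ)
    {g : Fin n → α → ℝ} (hg : ∀ i, Measurable (g i))
    (hint : ∀ i, ∫⁻ v, ENNReal.ofReal (Real.exp (g i v)) ∂μ ≤ 1) (x : ℝ) :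
    Measure.pi (fun _ => μ) {v : Fin n → α | ∃ S : Finset (Fin n), IsInitialSegment X S ∧
      x ≤ ∑ i ∈ S, g i (v i)} ≤ ENNReal.ofReal (Real.exp (-x)) := by
  induction n generalizing x with
  | zero =>
    rcases le_or_gt x 0 with hx | hx
    · exact prob_le_one.trans (ENNReal.one_le_ofReal.2 (Real.one_le_exp (by linarith)))
    · simp [Subsingleton.elim _ (∅ : Finset (Fin 0)), hx.not_ge]
  | succ n ih =>
    rcases le_or_gt x 0 with hx | hx
    · exact prob_le_one.trans (ENNReal.one_le_ofReal.2 (Real.one_le_exp (by linarith)))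
    obtain ⟨i₀, hi₀⟩ := Finite.exists_min X
    let A : Set (α × (Fin n → α)) := {p | ∃ S : Finset (Fin n),
      IsInitialSegment (X ∘ i₀.succAbove) S ∧
        x - g i₀ p.1 ≤ ∑ i ∈ S, g (i₀.succAbove i) (p.2 i)}
    have hA : MeasurableSet A := measurableSet_exists_finset_le_sum
      (p := fun S _ => IsInitialSegment (X ∘ i₀.succAbove) S)
      (g := fun i (p : α × (Fin n → α)) => g (i₀.succAbove i) (p.2 i))
      (fun _ => MeasurableSet.const _)
      (measurable_const.sub ((hg i₀).comp measurable_fst)) fun i => (hg _).comp (by fun_prop)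
    have hpres := measurePreserving_piFinSuccAbove (fun _ : Fin (n + 1) => μ) i₀
    refine (measure_mono fun v => exists_initialSegment_succAbove hi₀ hx).trans ?_
    refine (hpres.measure_preimage hA.nullMeasurableSet).trans_le ?_
    rw [Measure.prod_apply hA]
    calc ∫⁻ w, Measure.pi (fun _ => μ) (Prod.mk w ⁻¹' A) ∂μ
        ≤ ∫⁻ w, ENNReal.ofReal (Real.exp (-x)) * ENNReal.ofReal (Real.exp (g i₀ w)) ∂μ := by
          refine lintegral_mono fun w => ?_
          rw [← ENNReal.ofReal_mul (Real.exp_nonneg _), ← Real.exp_add, neg_add_eq_sub,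
            ← neg_sub]
          exact ih (X ∘ i₀.succAbove) (fun _ => hg _) (fun _ => hint _) (x - g i₀ w)
      _ = ENNReal.ofReal (Real.exp (-x)) * ∫⁻ w, ENNReal.ofReal (Real.exp (g i₀ w)) ∂μ :=
          lintegral_const_mul _ (by have := hg i₀; fun_prop)
      _ ≤ ENNReal.ofReal (Real.exp (-x)) := mul_le_of_le_one_right' (hint i₀)

theorem lintegral_exp_le_of_mem_Icc {W : α → ℝ} (hW : Measurable W) {a b : ℝ}
    (hab : ∀ v, W v ∈ Icc a b) (l : ℝ) :
    ∫⁻ v, ENNReal.ofReal (Real.exp (l * W v)) ∂μ ≤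
      ENNReal.ofReal (Real.exp (l * ∫ v, W v ∂μ + l ^ 2 * (b - a) ^ 2 / 8)) := by
  have hsub := ProbabilityTheory.hasSubgaussianMGF_of_mem_Icc (μ := μ) hW.aemeasurable
    (ae_of_all _ hab)
  have hshift : ∀ v, Real.exp (l * W v) =
      Real.exp (l * ∫ v, W v ∂μ) * Real.exp (l * (W v - ∫ v, W v ∂μ)) := fun v => by
    rw [← Real.exp_add]
    ring_nf
  simp only [hshift]
  rw [← ofReal_integral_eq_lintegral_ofReal ((hsub.integrable_exp_mul l).const_mul _)
    (ae_of_all _ fun v => by positivity), integral_const_mul, Real.exp_add]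
  gcongr
  refine (hsub.mgf_le l).trans_eq ?_
  simp only [NNReal.coe_pow, NNReal.coe_div, coe_nnnorm, Real.norm_eq_abs, div_pow, sq_abs,
    NNReal.coe_ofNat]
  ring_nf

theorem lintegral_exp_sub_le_one_of_mem_Icc {W : α → ℝ} (hW : Measurable W) {a b : ℝ}
    (hab : ∀ v, W v ∈ Icc a b) (l : ℝ) :
    ∫⁻ v, ENNReal.ofReal
      (Real.exp (l * W v - (l * ∫ v, W v ∂μ + l ^ 2 * (b - a) ^ 2 / 8))) ∂μ ≤ 1 := by
  simp only [Real.exp_sub, ENNReal.ofReal_div_of_pos (Real.exp_pos _)]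
  simp only [div_eq_mul_inv]
  rw [lintegral_mul_const _ (by fun_prop), ← div_eq_mul_inv]
  exact ENNReal.div_le_of_le_mul ((lintegral_exp_le_of_mem_Icc hW hab l).trans_eq (one_mul _).symm)

theorem lintegral_exp_sum_le_of_mem_Icc {φ : α → ℝ} (hφ : Measurable φ) {a b : ℝ}
    (hab : ∀ u, φ u ∈ Icc a b) (l : ℝ) (N : ℕ) :
    ∫⁻ u, ENNReal.ofReal (Real.exp (l * ∑ i, φ (u i))) ∂Measure.pi (fun _ : Fin N => μ) ≤
      ENNReal.ofReal (Real.exp (N * (l * ∫ u, φ u ∂μ + l ^ 2 * (b - a) ^ 2 / 8))) := by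
  let f : α → ENNReal := fun u => ENNReal.ofReal (Real.exp (l * φ u))
  have hf : Measurable f := by fun_prop
  calc ∫⁻ u, ENNReal.ofReal (Real.exp (l * ∑ i, φ (u i))) ∂Measure.pi (fun _ : Fin N => μ)
      = ∫⁻ u, ∏ i, f (u i) ∂Measure.pi (fun _ : Fin N => μ) := by
        simp only [Finset.mul_sum, Real.exp_sum, f,
          ENNReal.ofReal_prod_of_nonneg fun _ _ => Real.exp_nonneg _]
    _ = ∏ i : Fin N, ∫⁻ u, f (u i) ∂Measure.pi (fun _ : Fin N => μ) :=
        ProbabilityTheory.lintegral_prod_eq_prod_lintegral_of_indepFun _ _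
          (ProbabilityTheory.iIndepFun_pi fun _ => hf.aemeasurable)
          fun i => hf.comp (measurable_pi_apply i)
    _ = (∫⁻ u, f u ∂μ) ^ N := by
        simp only [(measurePreserving_eval (fun _ : Fin N => μ) _).lintegral_comp hf,
          Finset.prod_const, Finset.card_univ, Fintype.card_fin]
    _ ≤ ENNReal.ofReal (Real.exp (l * ∫ u, φ u ∂μ + l ^ 2 * (b - a) ^ 2 / 8)) ^ N := by
        gcongr
        exact lintegral_exp_le_of_mem_Icc hφ hab l
    _ = _ := by rw [← ENNReal.ofReal_pow (Real.exp_nonneg _), ← Real.exp_nat_mul]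

theorem lintegral_exp_neg_sum_sub_le {φ : α → ℝ} (hφ : Measurable φ)
    (hφ01 : ∀ u, φ u ∈ Icc (0 : ℝ) 1) {m : ℝ} (hm : ∫ u, φ u ∂μ = m) (N : ℕ) :
    ∫⁻ u, ENNReal.ofReal (Real.exp (-(m * ∑ i, φ (u i) - N * (m ^ 2 / 2))))
        ∂Measure.pi (fun _ : Fin N => μ) ≤
      ENNReal.ofReal (Real.exp (-(3 / 8 * N * m ^ 2))) := by
  have hexp := lintegral_exp_sum_le_of_mem_Icc (μ := μ) hφ hφ01 (-m) N
  rw [hm] at hexp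
  calc ∫⁻ u, ENNReal.ofReal (Real.exp (-(m * ∑ i, φ (u i) - N * (m ^ 2 / 2))))
        ∂Measure.pi (fun _ : Fin N => μ)
      = ∫⁻ u, ENNReal.ofReal (Real.exp (N * (m ^ 2 / 2))) * ENNReal.ofReal
          (Real.exp (-m * ∑ i, φ (u i))) ∂Measure.pi (fun _ : Fin N => μ) := by
        simp only [← ENNReal.ofReal_mul (Real.exp_nonneg _), ← Real.exp_add, neg_sub, neg_mul,
          ← sub_eq_add_neg]
    _ = ENNReal.ofReal (Real.exp (N * (m ^ 2 / 2))) * ∫⁻ u, ENNReal.ofReal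
          (Real.exp (-m * ∑ i, φ (u i))) ∂Measure.pi (fun _ : Fin N => μ) :=
        lintegral_const_mul _ (by fun_prop)
    _ ≤ ENNReal.ofReal (Real.exp (N * (m ^ 2 / 2))) *
          ENNReal.ofReal (Real.exp (N * (-m * m + (-m) ^ 2 * (1 - 0) ^ 2 / 8))) := by
        gcongr
    _ = ENNReal.ofReal (Real.exp (-(3 / 8 * N * m ^ 2))) := by
        rw [← ENNReal.ofReal_mul (Real.exp_nonneg _), ← Real.exp_add]
        ring_nf

theorem measure_exists_initialSegment_prod_le {N : ℕ} {X : α → ℝ} (hX : Measurable X)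
    {g : α → β → ℝ} (hg : Measurable (Function.uncurry g))
    (hint : ∀ u, ∫⁻ v, ENNReal.ofReal (Real.exp (g u v)) ∂ν ≤ 1) {x : (Fin N → α) → ℝ}
    (hx : Measurable x) :
    Measure.pi (fun _ : Fin N => μ.prod ν) {z | ∃ S : Finset (Fin N),
        IsInitialSegment (fun i => X (z i).1) S ∧
          x (fun i => (z i).1) ≤ ∑ i ∈ S, g (z i).1 (z i).2} ≤
      ∫⁻ u, ENNReal.ofReal (Real.exp (-x u)) ∂Measure.pi (fun _ : Fin N => μ) := by
  let A : Set ((Fin N → α) × (Fin N → β)) := {p | ∃ S : Finset (Fin N),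
    IsInitialSegment (fun i => X (p.1 i)) S ∧ x p.1 ≤ ∑ i ∈ S, g (p.1 i) (p.2 i)}
  have hA : MeasurableSet A := measurableSet_exists_finset_le_sum
    (measurableSet_isInitialSegment (X := fun i p => X (p.1 i)) fun i => by fun_prop)
    (by fun_prop) fun i =>
      hg.comp (f := fun p : (Fin N → α) × (Fin N → β) => (p.1 i, p.2 i)) (by fun_prop)
  have hpres := measurePreserving_arrowProdEquivProdArrow α β (Fin N) (fun _ => μ) (fun _ => ν)
  refine (hpres.measure_preimage hA.nullMeasurableSet).trans_le ?_
  rw [Measure.prod_apply hA]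
  exact lintegral_mono fun u => measure_exists_initialSegment_le_sum_le (fun i => X (u i))
    (fun i => hg.comp measurable_prodMk_left) (fun i => hint (u i)) (x u)

theorem measure_exists_initialSegment_sum_nonpos_le {X : α → ℝ} (hX : Measurable X)
    {W : α → β → ℝ} (hW : Measurable (Function.uncurry W)) (hbound : ∀ u v, W u v ∈ Icc (-1 : ℝ) 1)
    (hmean : ∀ u, 0 ≤ ∫ v, W u v ∂ν) {B : Set α} (hB : MeasurableSet B) (N : ℕ) :
    Measure.pi (fun _ : Fin N => μ.prod ν) {z | ∃ S : Finset (Fin N),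
        IsInitialSegment (fun i => X (z i).1) S ∧ (∀ i, (z i).1 ∈ B → i ∈ S) ∧
          ∑ i ∈ S, W (z i).1 (z i).2 ≤ 0} ≤
      ENNReal.ofReal (Real.exp (-(3 / 8 * N * (∫ u in B, ∫ v, W u v ∂ν ∂μ) ^ 2))) := by
  let h : α → ℝ := fun u => ∫ v, W u v ∂ν
  have hh : Measurable h := hW.stronglyMeasurable.integral_prod_right.measurable
  have hh1 : ∀ u, h u ≤ 1 := fun u => by
    have hi : Integrable (W u) ν := Integrable.of_mem_Icc (-1) 1
      (hW.comp measurable_prodMk_left).aemeasurable (ae_of_all _ (hbound u))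
    simpa using integral_mono hi (integrable_const 1) fun v => (hbound u v).2
  have hφ : ∀ u, B.indicator h u ∈ Icc (0 : ℝ) 1 := fun u =>
    ⟨indicator_nonneg (fun u _ => hmean u) u,
      indicator_le' (fun u _ => hh1 u) (fun _ _ => zero_le_one) u⟩
  have hφm : Measurable (B.indicator h) := hh.indicator hB
  let m := ∫ u in B, h u ∂μ
  have hm : ∫ u, B.indicator h u ∂μ = m := integral_indicator hB
  have hm0 : 0 ≤ m := setIntegral_nonneg hB fun u _ => hmean u
  let g : α → β → ℝ := fun u v => -m * W u v - (-m * h u + m ^ 2 / 2)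
  have hg : Measurable (Function.uncurry g) :=
    (hW.const_mul _).sub (((hh.comp measurable_fst).const_mul _).add_const _)
  have hint : ∀ u, ∫⁻ v, ENNReal.ofReal (Real.exp (g u v)) ∂ν ≤ 1 := fun u => by
    convert lintegral_exp_sub_le_one_of_mem_Icc (μ := ν) (W := W u)
      (hW.comp measurable_prodMk_left) (hbound u) (-m) using 6
    ring
  refine (measure_mono ?_).trans ((measure_exists_initialSegment_prod_le hX hg hint
    (x := fun u => m * ∑ i, B.indicator h (u i) - N * (m ^ 2 / 2)) (by fun_prop)).trans
    (lintegral_exp_neg_sum_sub_le hφm hφ hm N))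
  rintro z ⟨S, hS, hBS, hsum⟩
  exact ⟨S, hS, mul_sum_indicator_sub_le_sum hmean hBS hsum hm0⟩

end Maximal

/-! ### Empirical risk minimization -/

/-- The sign of a label; the same type encodes the two directions on the line. -/
def boolSign : Bool → ℝ
  | true => 1
  | false => -1

/-- The empirical risk of the threshold classifier at `y`, up to an additive constant and scaling:
moving the threshold to the right past a sample point turns a correct label `s` into an error. -/
noncomputable def empiricalRisk (s : ℝ) {N : ℕ} (D : Fin N → ℝ × Bool) (y : ℝ) : ℝ :=
  ∑ i, (Iic y).indicator (fun _ => s * boolSign (D i).2) (D i).1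

/-- The left end point of `[a, b]` and the sample points, the latter clamped to `[a, b]`; the
empirical risk takes no further values on `[a, b]` if the sample lies in `[a, b]`. -/
def candidates (a b : ℝ) {N : ℕ} (D : Fin N → ℝ × Bool) : Fin (N + 1) → ℝ :=
  Fin.cons a fun i => max a (min b (D i).1)

theorem exists_measurable_argmin (ι : Type*) [Finite ι] [Nonempty ι] [MeasurableSpace ι] :
    ∃ sel : (ι → ℝ) → ι, Measurable sel ∧ ∀ (f : ι → ℝ) i, f (sel f) ≤ f i := by
  classical
  obtain ⟨e, he⟩ := exists_surjective_nat ι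
  have hex : ∀ f : ι → ℝ, ∃ n, ∀ i, f (e n) ≤ f i := fun f => by
    obtain ⟨j, hj⟩ := Finite.exists_min f
    obtain ⟨n, rfl⟩ := he j
    exact ⟨n, hj⟩
  refine ⟨fun f => e (Nat.find (hex f)), (measurable_from_nat (f := e)).comp
    (measurable_find hex fun n => ?_), fun f => Nat.find_spec (hex f)⟩
  simp only [ofPred_forall]
  exact MeasurableSet.iInter fun i =>
    measurableSet_le (measurable_pi_apply _) (measurable_pi_apply _)

/-- A measurable choice of a minimizer of the empirical risk over `[a, b]`. -/
noncomputable def empiricalMinimizer (s a b : ℝ) {N : ℕ} (D : Fin N → ℝ × Bool) : ℝ :=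
  candidates a b D ((exists_measurable_argmin (Fin (N + 1))).choose
    fun j => empiricalRisk s D (candidates a b D j))

section EmpiricalMinimizer

variable {s a b : ℝ} {N : ℕ} {D : Fin N → ℝ × Bool}

theorem candidates_mem_Icc (hab : a ≤ b) (D : Fin N → ℝ × Bool) (j : Fin (N + 1)) :
    candidates a b D j ∈ Icc a b := by
  cases j using Fin.cases with
  | zero => exact left_mem_Icc.2 hab
  | succ i => exact ⟨le_max_left _ _, max_le hab (min_le_left _ _)⟩

theorem exists_candidates_le_iff (hD : ∀ i, (D i).1 ∈ Icc a b) {y : ℝ} (hy : a ≤ y) :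
    ∃ j, ∀ i, (D i).1 ≤ candidates a b D j ↔ (D i).1 ≤ y := by
  by_cases hne : ∃ i, (D i).1 ≤ y
  · have : Nonempty {i // (D i).1 ≤ y} := nonempty_subtype.2 hne
    obtain ⟨⟨j, hj⟩, hmax⟩ := Finite.exists_max fun i : {i // (D i).1 ≤ y} => (D i).1
    have hcand : candidates a b D j.succ = (D j).1 := by
      rw [candidates, Fin.cons_succ, min_eq_right (hD j).2, max_eq_right (hD j).1]
    exact ⟨j.succ, fun i => hcand ▸ ⟨fun h => h.trans hj, fun h => hmax ⟨i, h⟩⟩⟩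
  · push Not at hne
    exact ⟨0, fun i => ⟨fun h => h.trans hy, fun h => absurd h (hne i).not_ge⟩⟩

theorem empiricalRisk_empiricalMinimizer_le (s : ℝ) (hD : ∀ i, (D i).1 ∈ Icc a b) {y : ℝ}
    (hy : a ≤ y) : empiricalRisk s D (empiricalMinimizer s a b D) ≤ empiricalRisk s D y := by
  obtain ⟨j, hj⟩ := exists_candidates_le_iff hD hy
  refine ((exists_measurable_argmin (Fin (N + 1))).choose_spec.2
    (fun j => empiricalRisk s D (candidates a b D j)) j).trans_eq ?_
  simp only [empiricalRisk, indicator, mem_Iic, hj]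

theorem measurable_empiricalRisk (s : ℝ) :
    Measurable fun p : (Fin N → ℝ × Bool) × ℝ => empiricalRisk s p.1 p.2 := by
  have hsign : Measurable boolSign := .of_discrete
  refine Finset.measurable_sum _ fun i _ => Measurable.indicator
    (f := fun p : (Fin N → ℝ × Bool) × ℝ => s * boolSign (p.1 i).2)
    (s := {p | (p.1 i).1 ≤ p.2}) (by fun_prop) (measurableSet_le (by fun_prop) (by fun_prop))

theorem measurable_empiricalMinimizer (s : ℝ) : Measurable fun p : ℝ × ℝ × (Fin N → ℝ × Bool) =>
    empiricalMinimizer s p.1 p.2.1 p.2.2 := by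
  have hcand : Measurable fun p : ℝ × ℝ × (Fin N → ℝ × Bool) => candidates p.1 p.2.1 p.2.2 := by
    refine measurable_pi_lambda _ fun j => ?_
    cases j using Fin.cases with
    | zero => exact measurable_fst
    | succ i => simp only [candidates, Fin.cons_succ]; fun_prop
  have heval : Measurable fun q : (Fin (N + 1) → ℝ) × Fin (N + 1) => q.1 q.2 :=
    measurable_from_prod_countable_left fun j => measurable_pi_apply j
  refine heval.comp (hcand.prodMk ((exists_measurable_argmin (Fin (N + 1))).choose_spec.1.comp
    (measurable_pi_lambda _ fun j => ?_)))
  exact (measurable_empiricalRisk s).comp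
    (f := fun p : ℝ × ℝ × (Fin N → ℝ × Bool) => (p.2.2, candidates p.1 p.2.1 p.2.2 j))
    ((by fun_prop : Measurable _).prodMk ((measurable_pi_apply j).comp hcand))

end EmpiricalMinimizer

theorem abs_boolSign_mul (d : Bool) (x : ℝ) : |boolSign d * x| = |x| := by
  cases d <;> simp [boolSign]

/-- The ray starting at `y` against the direction `d`. -/
def backRay (d : Bool) (y : ℝ) : Set ℝ := if d then Iic y else Ioi y

theorem mem_backRay_of_le {d : Bool} {y z w : ℝ} (hz : z ∈ backRay d y)
    (h : boolSign d * w ≤ boolSign d * z) : w ∈ backRay d y := by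
  cases d <;> simp only [backRay, boolSign, if_true, Bool.false_eq_true, if_false, mem_Iic, mem_Ioi]
    at * <;> linarith

theorem measurableSet_backRay (d : Bool) (y : ℝ) : MeasurableSet (backRay d y) := by
  cases d
  · exact measurableSet_Ioi
  · exact measurableSet_Iic

theorem uIoc_subset_backRay {d : Bool} {p q y : ℝ} (hpq : boolSign d * p ≤ boolSign d * q)
    (hqy : boolSign d * q ≤ boolSign d * y) : uIoc p q ⊆ backRay d y := by
  intro z hz
  cases d <;> simp only [backRay, boolSign, if_true, Bool.false_eq_true, if_false, mem_Iic,
    mem_Ioi, one_mul, neg_one_mul, neg_le_neg_iff] at *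
  · rw [uIoc_of_ge hpq] at hz
    exact hqy.trans_lt hz.1
  · rw [uIoc_of_le hpq] at hz
    exact hz.2.trans hqy

theorem uIoc_subset_compl_backRay {d : Bool} {p q : ℝ} (hpq : boolSign d * p ≤ boolSign d * q) :
    uIoc p q ⊆ (backRay d p)ᶜ := by
  intro z hz
  cases d <;> simp only [backRay, boolSign, if_true, Bool.false_eq_true, if_false, mem_compl_iff,
    mem_Iic, mem_Ioi, one_mul, neg_one_mul, neg_le_neg_iff, not_lt, not_le] at *
  · rw [uIoc_of_ge hpq] at hz
    exact hz.2
  · rw [uIoc_of_le hpq] at hz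
    exact hz.1

theorem empiricalRisk_sub_eq_sum (s : ℝ) {N : ℕ} (D : Fin N → ℝ × Bool) {d : Bool}
    {p y : ℝ} (h : boolSign d * p ≤ boolSign d * y) :
    empiricalRisk s D y - empiricalRisk s D p =
      ∑ i, (backRay d y).indicator ((backRay d p)ᶜ.indicator fun _ =>
        boolSign d * (s * boolSign (D i).2)) (D i).1 := by
  simp only [empiricalRisk, ← Finset.sum_sub_distrib]
  refine Finset.sum_congr rfl fun i _ => ?_
  generalize s * boolSign (D i).2 = v
  cases d <;> simp only [backRay, boolSign, indicator, if_true, Bool.false_eq_true, if_false,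
    mem_compl_iff, mem_Iic, mem_Ioi, not_lt, not_le] at * <;> split_ifs <;> linarith

/-! ### The excess risk of empirical risk minimization -/

/-- A point of `[a, b]`; uniformly distributed there if `u` is uniform on `[0, 1]`. -/
def uniformPoint (a b : ℝ) (u : unitInterval) : ℝ := a + u * (b - a)

/-- A labelled sample of uniform points of `[a, b]`. -/
noncomputable def uniformSample (η : ℝ → ℝ) (a b : ℝ) {N : ℕ}
    (z : Fin N → unitInterval × unitInterval) : Fin N → ℝ × Bool :=
  fun i => (uniformPoint a b (z i).1, label η (uniformPoint a b (z i).1) (z i).2)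

section Deviation

variable {s a b : ℝ} {η : ℝ → ℝ}

theorem measurable_uniformPoint (a b : ℝ) : Measurable (uniformPoint a b) := by
  unfold uniformPoint
  fun_prop

theorem uniformPoint_mem_Icc (hab : a ≤ b) (u : unitInterval) : uniformPoint a b u ∈ Icc a b :=
  ⟨le_add_of_nonneg_right (mul_nonneg u.2.1 (sub_nonneg.2 hab)),
    add_le_of_le_sub_left (mul_le_of_le_one_left (sub_nonneg.2 hab) u.2.2)⟩

theorem integral_comp_uniformPoint (hab : a < b) (F : ℝ → ℝ) :
    ∫ u, F (uniformPoint a b u) = (∫ z in a..b, F z) / (b - a) := by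
  calc ∫ u, F (uniformPoint a b u) = ∫ x in (0 : ℝ)..1, F (a + (b - a) * x) := by
        rw [intervalIntegral.integral_of_le zero_le_one, ← integral_Icc_eq_integral_Ioc,
          ← unitInterval.measurePreserving_coe.integral_comp unitInterval.measurableEmbedding_coe]
        simp only [uniformPoint, mul_comm]
    _ = (∫ z in a..b, F z) / (b - a) := by
        rw [intervalIntegral.integral_comp_add_mul _ (sub_ne_zero.2 hab.ne')]
        simp [div_eq_inv_mul]

theorem integral_boolSign_label {q : ℝ} (hq : η q ∈ Icc (0 : ℝ) 1) :
    ∫ v : unitInterval, boolSign (label η q v) = 2 * η q - 1 := by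
  have hind : ∀ v : unitInterval, boolSign (label η q v) =
      2 * (Iic (⟨η q, hq⟩ : unitInterval)).indicator 1 v - 1 := fun v => by
    by_cases hv : (v : ℝ) ≤ η q
    · norm_num [label, boolSign, indicator, ← Subtype.coe_le_coe, hv]
    · simp [label, boolSign, indicator, ← Subtype.coe_le_coe, hv]
  simp only [hind]
  rw [integral_sub (((integrable_const 1).indicator measurableSet_Iic).const_mul 2)
    (integrable_const 1), integral_const_mul, integral_indicator_one measurableSet_Iic]
  simp [measureReal_def, hq.1]

/-- The contribution of a query to the empirical risk lost by moving from `p` in the direction `d`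
past the query. -/
noncomputable def overshootStep (s : ℝ) (η : ℝ → ℝ) (a b : ℝ) (d : Bool) (p : ℝ)
    (u v : unitInterval) : ℝ :=
  (backRay d p)ᶜ.indicator (fun w => boolSign d * (s * boolSign (label η w v)))
    (uniformPoint a b u)

theorem measurable_overshootStep (hη : Measurable η) (d : Bool) (p : ℝ) :
    Measurable (Function.uncurry (overshootStep s η a b d p)) := by
  have hsign : Measurable boolSign := .of_discrete
  have hpoint : Measurable fun w : unitInterval × unitInterval => uniformPoint a b w.1 :=
    (measurable_uniformPoint a b).comp measurable_fst
  refine Measurable.indicator (f := fun w : unitInterval × unitInterval =>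
    boolSign d * (s * boolSign (label η (uniformPoint a b w.1) w.2)))
    (Measurable.const_mul (Measurable.const_mul
      (hsign.comp ((measurable_label hη).comp (hpoint.prodMk measurable_snd))) s) _)
    (hpoint (measurableSet_backRay d p).compl)

theorem overshootStep_mem_Icc (hs : |s| ≤ 1) (d : Bool) (p : ℝ) (u v : unitInterval) :
    overshootStep s η a b d p u v ∈ Icc (-1) 1 := by
  rw [mem_Icc, ← abs_le, overshootStep, indicator]
  split_ifs
  · rw [abs_boolSign_mul, abs_mul]
    cases label η (uniformPoint a b u) v <;> simpa [boolSign] using hs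
  · simp

theorem integral_overshootStep (hab : a ≤ b) (hprob : ∀ z ∈ Icc a b, η z ∈ Icc (0 : ℝ) 1)
    (s : ℝ) (d : Bool) (p : ℝ) (u : unitInterval) :
    ∫ v, overshootStep s η a b d p u v =
      (backRay d p)ᶜ.indicator (fun w => boolSign d * (s * (2 * η w - 1)))
        (uniformPoint a b u) := by
  simp only [overshootStep, indicator]
  split_ifs
  · rw [integral_const_mul, integral_const_mul,
      integral_boolSign_label (hprob _ (uniformPoint_mem_Icc hab u))]
  · exact integral_zero _ _

theorem setIntegral_integral_overshootStep (hs : |s| = 1) (hab : a < b)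
    (hprob : ∀ z ∈ Icc a b, η z ∈ Icc (0 : ℝ) 1) {d : Bool} {p q : ℝ} (hp : p ∈ Icc a b)
    (hq : q ∈ Icc a b) (hpq : boolSign d * p ≤ boolSign d * q)
    (hdrift : ∀ z ∈ Icc a b, z ∉ backRay d p → 0 ≤ boolSign d * (s * (2 * η z - 1))) :
    ∫ u in uniformPoint a b ⁻¹' uIoc p q, ∫ v, overshootStep s η a b d p u v =
      excessRisk η p q / (b - a) := by
  have hsub : uIoc p q ⊆ Icc a b := uIoc_subset_uIcc.trans (uIcc_subset_Icc hp hq)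
  have hsub' : uIoc p q ⊆ Ioc a b := Ioc_subset_Ioc (le_min hp.1 hq.1) (max_le hp.2 hq.2)
  calc ∫ u in uniformPoint a b ⁻¹' uIoc p q, ∫ v, overshootStep s η a b d p u v
      = ∫ u in uniformPoint a b ⁻¹' uIoc p q, |2 * η (uniformPoint a b u) - 1| := by
        refine setIntegral_congr_fun (measurable_uniformPoint a b measurableSet_uIoc) fun u hu => ?_
        have hcompl := uIoc_subset_compl_backRay hpq hu
        simp only [integral_overshootStep hab.le hprob, indicator_of_mem hcompl]
        rw [← abs_of_nonneg (hdrift _ (hsub hu) hcompl), abs_boolSign_mul, abs_mul, hs, one_mul]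
    _ = ∫ u, (uIoc p q).indicator (fun w => |2 * η w - 1|) (uniformPoint a b u) := by
        rw [← integral_indicator (measurable_uniformPoint a b measurableSet_uIoc)]
        rfl
    _ = excessRisk η p q / (b - a) := by
        rw [integral_comp_uniformPoint hab, intervalIntegral.integral_of_le hab.le,
          setIntegral_indicator measurableSet_uIoc, inter_eq_self_of_subset_right hsub',
          excessRisk_eq_setIntegral]

theorem measure_exists_empiricalRisk_le_of_le (hs : |s| = 1) (hab : a < b) (hη : Measurable η)
    (hprob : ∀ z ∈ Icc a b, η z ∈ Icc (0 : ℝ) 1) {d : Bool} {p q : ℝ} (hp : p ∈ Icc a b)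
    (hq : q ∈ Icc a b) (hpq : boolSign d * p ≤ boolSign d * q)
    (hdrift : ∀ z ∈ Icc a b, z ∉ backRay d p → 0 ≤ boolSign d * (s * (2 * η z - 1))) (N : ℕ) :
    volume {z : Fin N → unitInterval × unitInterval | ∃ y, boolSign d * q ≤ boolSign d * y ∧
      empiricalRisk s (uniformSample η a b z) y ≤ empiricalRisk s (uniformSample η a b z) p} ≤
      ENNReal.ofReal (Real.exp (-(3 / 8 * N * (excessRisk η p q / (b - a)) ^ 2))) := by
  classical
  have hmean : ∀ u, 0 ≤ ∫ v, overshootStep s η a b d p u v := fun u => by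
    rw [integral_overshootStep hab.le hprob, indicator]
    split_ifs with hu
    exacts [hdrift _ (uniformPoint_mem_Icc hab.le u) hu, le_rfl]
  rw [← setIntegral_integral_overshootStep hs hab hprob hp hq hpq hdrift]
  refine (measure_mono ?_).trans (measure_exists_initialSegment_sum_nonpos_le
    ((measurable_uniformPoint a b).const_mul (boolSign d)) (measurable_overshootStep hη d p)
    (overshootStep_mem_Icc hs.le d p) hmean (measurable_uniformPoint a b measurableSet_uIoc) N)
  rintro z ⟨y, hqy, hle⟩
  refine ⟨Finset.univ.filter fun i => uniformPoint a b (z i).1 ∈ backRay d y,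
    fun i hi j hij => ?_, fun i hi => ?_, ?_⟩
  · exact Finset.mem_filter.2 ⟨Finset.mem_univ _, mem_backRay_of_le (Finset.mem_filter.1 hi).2 hij⟩
  · exact Finset.mem_filter.2 ⟨Finset.mem_univ _, uIoc_subset_backRay hpq hqy hi⟩
  · rw [← sub_nonpos, empiricalRisk_sub_eq_sum s _ (hpq.trans hqy)] at hle
    rw [Finset.sum_filter]
    exact hle

theorem mem_uIcc_of_boolSign_mul_le {d : Bool} {p q y : ℝ} (hpy : boolSign d * p ≤ boolSign d * y)
    (hyq : boolSign d * y ≤ boolSign d * q) : y ∈ uIcc p q := by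
  cases d <;> simp only [boolSign, one_mul, neg_one_mul, neg_le_neg_iff] at *
  exacts [mem_uIcc_of_ge hyq hpy, mem_uIcc_of_le hpy hyq]

theorem boolSign_mul_le_of_mem_uIcc {d : Bool} {p q y : ℝ} (hq : q ∈ uIcc p y)
    (hpy : boolSign d * p ≤ boolSign d * y) : boolSign d * p ≤ boolSign d * q := by
  cases d <;> simp only [boolSign, one_mul, neg_one_mul, neg_le_neg_iff] at *
  · rw [uIcc_of_ge hpy] at hq
    exact hq.2
  · rw [uIcc_of_le hpy] at hq
    exact hq.1

theorem coe_projIcc_mem_uIcc (hab : a ≤ b) (t : ℝ) {y : ℝ} (hy : y ∈ Icc a b) :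
    (projIcc a b hab t : ℝ) ∈ uIcc t y := by
  rw [coe_projIcc]
  rcases le_total t y with h | h
  · exact mem_uIcc_of_le (le_max_of_le_right (le_min (h.trans hy.2) le_rfl))
      (max_le hy.1 ((min_le_right _ _).trans h))
  · exact mem_uIcc_of_ge (le_max_of_le_right (le_min hy.2 h))
      (max_le (hy.1.trans h) (min_le_right _ _))

variable {R t : ℝ}

theorem IsThreshold.drift_nonneg (hη : IsThreshold s R η t) (hab : a ≤ b)
    (hsub : Icc a b ⊆ Icc 0 R) {d : Bool} {q : ℝ} (hq : q ∈ Icc a b)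
    (hpq : boolSign d * projIcc a b hab t < boolSign d * q) {z : ℝ} (hz : z ∈ Icc a b)
    (hzp : z ∉ backRay d (projIcc a b hab t)) : 0 ≤ boolSign d * (s * (2 * η z - 1)) := by
  rw [coe_projIcc] at hpq hzp
  cases d <;> simp only [backRay, boolSign, if_true, Bool.false_eq_true, if_false, mem_Iic,
    mem_Ioi, one_mul, neg_one_mul, neg_lt_neg_iff, not_lt, not_le] at *
  · have hzt : z ≤ t := by
      rcases le_max_iff.1 hzp with h | h
      · exact (h.trans hq.1).trans ((lt_max_iff.1 hpq).resolve_left hq.1.not_gt |>.le.trans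
          (min_le_right _ _))
      · exact h.trans (min_le_right _ _)
    rcases hzt.eq_or_lt with rfl | hlt
    · simp [hη.half]
    · linarith [hη.left z (hsub hz) hlt]
  · have htz : t < z := (min_lt_iff.1 ((le_max_right _ _).trans_lt hzp)).resolve_left hz.2.not_gt
    linarith [hη.right z (hsub hz) htz]

theorem measure_exists_overshoot_le (hs : |s| = 1) (hη : IsThreshold s R η t) (hab : a < b)
    (hsub : Icc a b ⊆ Icc 0 R) {p : ℝ} (hpt : projIcc a b hab.le t = p) {ε : ℝ} (hε : 0 < ε)
    (N : ℕ) (d : Bool) :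
    volume {z : Fin N → unitInterval × unitInterval | ∃ y ∈ Icc a b,
      boolSign d * p ≤ boolSign d * y ∧ ε < excessRisk η p y ∧
        empiricalRisk s (uniformSample η a b z) y ≤ empiricalRisk s (uniformSample η a b z) p} ≤
      ENNReal.ofReal (Real.exp (-(3 / 8 * N * (ε / (b - a)) ^ 2))) := by
  have hp : p ∈ Icc a b := hpt ▸ (projIcc a b hab.le t).2
  have hint := hη.integrableOn.mono_set hsub
  by_cases hex : ∃ y ∈ Icc a b, boolSign d * p ≤ boolSign d * y ∧ ε < excessRisk η p y
  · obtain ⟨y₀, hy₀, hpy₀, hεy₀⟩ := hex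
    obtain ⟨q, hqy₀, rfl⟩ : ε ∈ excessRisk η p '' uIcc p y₀ :=
      intermediate_value_uIcc (continuousOn_excessRisk hint (uIcc_subset_Icc hp hy₀))
        (excessRisk_self η p ▸ mem_uIcc_of_le hε.le hεy₀.le)
    have hq : q ∈ Icc a b := uIcc_subset_Icc hp hy₀ hqy₀
    have hpq : boolSign d * p ≤ boolSign d * q := boolSign_mul_le_of_mem_uIcc hqy₀ hpy₀
    have hpq' : boolSign d * p < boolSign d * q := by
      refine hpq.lt_of_ne fun h => hε.ne ?_
      have hqp : q ∈ uIcc p p := mem_uIcc_of_boolSign_mul_le hpq h.ge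
      rw [uIcc_self, mem_singleton_iff] at hqp
      rw [hqp, excessRisk_self]
    refine (measure_mono ?_).trans (measure_exists_empiricalRisk_le_of_le hs hab hη.measurable
      (fun z hz => hη.prob z (hsub hz)) hp hq hpq
      (fun z hz hzp => hη.drift_nonneg hab.le hsub hq (hpt ▸ hpq') hz (hpt ▸ hzp)) N)
    rintro z ⟨y, -, hpy, hlt, hle⟩
    refine ⟨y, le_of_not_gt fun hyq => hlt.not_ge ?_, hle⟩
    exact excessRisk_mono hint (uIcc_subset_Icc hp hq) (mem_uIcc_of_boolSign_mul_le hpy hyq.le)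
  · refine (measure_mono (t := ∅) ?_).trans (by simp)
    rintro z ⟨y, hy, hpy, hlt, -⟩
    exact hex ⟨y, hy, hpy, hlt⟩

theorem exists_overshoot (hη : IsThreshold s R η t) (hab : a ≤ b) (hsub : Icc a b ⊆ Icc 0 R)
    {p : ℝ} (hpt : projIcc a b hab t = p) {N : ℕ} {D : Fin N → ℝ × Bool}
    (hD : ∀ i, (D i).1 ∈ Icc a b) {y ε : ℝ} (hy : y ∈ Icc a b)
    (hlt : ε < excessRisk η t (empiricalMinimizer s a b D) - excessRisk η t y) :
    ∃ d, ∃ x ∈ Icc a b, boolSign d * p ≤ boolSign d * x ∧ ε < excessRisk η p x ∧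
      empiricalRisk s D x ≤ empiricalRisk s D p := by
  have hp : p ∈ Icc a b := hpt ▸ (projIcc a b hab t).2
  have hx : empiricalMinimizer s a b D ∈ Icc a b := candidates_mem_Icc hab D _
  have hεx := hlt.trans_le (excessRisk_sub_le hη.integrableOn
    (hpt ▸ coe_projIcc_mem_uIcc hab t hy) (uIcc_subset_Icc hη.mem (hsub hy))
    (uIcc_subset_Icc (hsub hp) (hsub hx)))
  have hle := empiricalRisk_empiricalMinimizer_le s hD hp.1
  rcases le_total p (empiricalMinimizer s a b D) with h | h
  · exact ⟨true, _, hx, by simpa [boolSign] using h, hεx, hle⟩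
  · exact ⟨false, _, hx, by simpa [boolSign] using h, hεx, hle⟩

theorem le_measure_excessRisk_empiricalMinimizer_sub_le (hs : |s| = 1) (hη : IsThreshold s R η t)
    (hab : a < b) (hsub : Icc a b ⊆ Icc 0 R) {ε δ : ℝ} (hε : 0 < ε) (hδ : 0 < δ) {N : ℕ}
    (hN : Real.log (2 / δ) ≤ 3 / 8 * N * (ε / (b - a)) ^ 2) {y : ℝ} (hy : y ∈ Icc a b) :
    ENNReal.ofReal (1 - δ) ≤ volume {z : Fin N → unitInterval × unitInterval |
      excessRisk η t (empiricalMinimizer s a b (uniformSample η a b z)) -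
        excessRisk η t y ≤ ε} := by
  obtain ⟨p, hpt⟩ : ∃ p : ℝ, projIcc a b hab.le t = p := ⟨_, rfl⟩
  let overshoot (d : Bool) : Set (Fin N → unitInterval × unitInterval) := {z | ∃ x ∈ Icc a b,
    boolSign d * p ≤ boolSign d * x ∧ ε < excessRisk η p x ∧
      empiricalRisk s (uniformSample η a b z) x ≤ empiricalRisk s (uniformSample η a b z) p}
  have hhalf : ∀ d, volume (overshoot d) ≤ ENNReal.ofReal (δ / 2) := fun d =>
    (measure_exists_overshoot_le hs hη hab hsub hpt hε N d).trans <| ENNReal.ofReal_le_ofReal <|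
      (Real.exp_le_exp.2 (neg_le_neg hN)).trans_eq <| by
        rw [Real.exp_neg, Real.exp_log (div_pos two_pos hδ), inv_div]
  rw [ENNReal.ofReal_sub _ hδ.le, ENNReal.ofReal_one, tsub_le_iff_right,
    ← measure_univ (μ := (volume : Measure (Fin N → unitInterval × unitInterval)))]
  refine (measure_univ_le_add_compl _).trans (add_le_add_right ?_ _)
  calc _ ≤ volume (⋃ d, overshoot d) := measure_mono fun z hz => mem_iUnion.2 <|
        exists_overshoot hη hab.le hsub hpt (fun i => uniformPoint_mem_Icc hab.le _) hy
          (not_le.1 (notMem_ofPred_iff.1 hz))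
    _ ≤ ENNReal.ofReal (δ / 2) + ENNReal.ofReal (δ / 2) := by
      refine (measure_iUnion_fintype_le _ _).trans ?_
      rw [Fintype.sum_bool]
      exact add_le_add (hhalf _) (hhalf _)
    _ = ENNReal.ofReal δ := by rw [← ENNReal.ofReal_add (by positivity) (by positivity), add_halves]

end Deviation

/-- Empirical risk minimization over the search region, as a passive procedure. -/
noncomputable def erm (s R : ℝ) : PassiveProcedure := fun x r _ D _ =>
  empiricalMinimizer s (max 0 (x - r)) (min R (x + r)) D

/-- A confidence factor of empirical risk minimization. -/
noncomputable def ermFactor (δ : ℝ) : ℝ := 4 * √(Real.log (2 / δ))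

theorem isConfidenceFactor_ermFactor : IsConfidenceFactor ermFactor := by
  constructor
  · rintro δ ⟨h0, h1⟩
    have hlog : Real.log 2 ≤ Real.log (2 / δ) :=
      Real.log_le_log two_pos (le_div_self zero_le_two h0 h1.le)
    have hlog2 := Real.log_two_gt_d9
    rw [ermFactor, Real.sqrt_lt' (mul_pos four_pos (Real.sqrt_pos.2 (by linarith))), mul_pow,
      Real.sq_sqrt (by linarith)]
    linarith
  · refine Asymptotics.IsBigO.of_bound 8 ?_
    filter_upwards [Ioo_mem_nhdsGT (one_half_pos (α := ℝ))] with δ ⟨h0, h1⟩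
    have hlog : Real.log (2 / δ) ≤ 2 ^ 2 * Real.log (1 / δ) := by
      have htwo : Real.log 2 ≤ Real.log (1 / δ) :=
        Real.log_le_log two_pos ((le_one_div two_pos h0).2 h1.le)
      rw [← mul_one_div, Real.log_mul two_ne_zero (one_div_pos.2 h0).ne']
      linarith [Real.log_pos one_lt_two]
    rw [ermFactor, Real.norm_of_nonneg (by positivity), Real.norm_of_nonneg (Real.sqrt_nonneg _)]
    calc 4 * √(Real.log (2 / δ)) ≤ 4 * √(2 ^ 2 * Real.log (1 / δ)) := by gcongr
      _ = 8 * √(Real.log (1 / δ)) := by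
        rw [Real.sqrt_mul (by positivity), Real.sqrt_sq zero_le_two]
        ring

theorem region_eq_Icc (R x r : ℝ) : region R x r = Icc (max 0 (x - r)) (min R (x + r)) :=
  Icc_inter_Icc

theorem max_sub_lt_min_add {R x r : ℝ} (hR : 0 < R) (hx : x ∈ Icc 0 R) (hr : 0 < r) :
    max 0 (x - r) < min R (x + r) :=
  max_lt (lt_min hR (by linarith [hx.1])) (lt_min (by linarith [hx.2]) (by linarith))

theorem log_le_of_ermFactor {r L δ : ℝ} (hL : 0 < L) (hLr : L ≤ 2 * r) (hδ : δ ∈ Ioc (0 : ℝ) 1)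
    {N : ℕ} (hN : 1 ≤ N) :
    Real.log (2 / δ) ≤ 3 / 8 * N * (ermFactor δ * r / √N / L) ^ 2 := by
  have hN0 : (0 : ℝ) < N := Nat.cast_pos.2 hN
  have hlog : 0 ≤ Real.log (2 / δ) :=
    Real.log_nonneg (one_le_two.trans (le_div_self zero_le_two hδ.1 hδ.2))
  have hratio : 1 ≤ (2 * r / L) ^ 2 := one_le_pow₀ ((one_le_div hL).2 hLr)
  calc Real.log (2 / δ) ≤ 3 / 2 * Real.log (2 / δ) * (2 * r / L) ^ 2 :=
        (le_mul_of_one_le_left hlog (by norm_num)).trans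
          (le_mul_of_one_le_right (by positivity) hratio)
    _ = 3 / 8 * N * (ermFactor δ * r / √N / L) ^ 2 := by
        rw [ermFactor, div_pow, div_pow, div_pow, mul_pow, mul_pow, mul_pow, Real.sq_sqrt hlog,
          Real.sq_sqrt hN0.le]
        field_simp
        ring

theorem isOptimalPassive_erm {s R : ℝ} (hR : 0 < R) (hs : s = 1 ∨ s = -1) :
    IsOptimalPassive s R ermFactor (erm s R) where
  measurable r N := (measurable_empiricalMinimizer s).comp
    (f := fun p : ℝ × (Fin N → ℝ × Bool) × unitInterval =>
      (max 0 (p.1 - r), min R (p.1 + r), p.2.1)) (by fun_prop)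
  mem_region x hx r hr N D w := by
    rw [region_eq_Icc]
    exact candidates_mem_Icc (max_sub_lt_min_add hR hx hr).le D _
  risk_le η t hη x hx r hr N hN δ hδ y hy := by
    rw [region_eq_Icc] at hy
    have hab := max_sub_lt_min_add hR hx hr
    have hLr : min R (x + r) - max 0 (x - r) ≤ 2 * r := by
      linarith [min_le_right R (x + r), le_max_right 0 (x - r)]
    have hs1 : |s| = 1 := by rcases hs with rfl | rfl <;> simp
    have hlog := log_le_of_ermFactor (sub_pos.2 hab) hLr (Ioo_subset_Ioc_self hδ) hN
    have hε : 0 < ermFactor δ * r / √N := by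
      have := (Real.sqrt_nonneg 2).trans_lt (isConfidenceFactor_ermFactor.1 δ hδ)
      positivity
    have hfst (A : Set (Fin N → unitInterval × unitInterval)) :
        volume A = volume {z : Seed N | z.1 ∈ A} := by
      rw [← mul_one (volume A), ← measure_univ (μ := (volume : Measure unitInterval)),
        ← Measure.prod_prod, prod_univ]
      rfl
    exact (le_measure_excessRisk_empiricalMinimizer_sub_le hs1 hη hab
      (Icc_subset_Icc (le_max_left _ _) (min_le_left _ _)) hε hδ.1 hlog hy).trans_eq (hfst _)

end ActiveThreshold

open ActiveThreshold in
theorem theorem1_general {R s : ℝ} (hR : 0 < R) (hs : s = 1 ∨ s = -1) :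
    (∃ (C : ℝ → ℝ) (P : PassiveProcedure), IsConfidenceFactor C ∧ IsOptimalPassive s R C P) ∧
    ∀ C : ℝ → ℝ, IsConfidenceFactor C →
    ∀ k c δ : ℝ, 2 ≤ k → 0 < c → 0 < δ →
    ∃ (K : ℝ) (p T₀ : ℕ), ∀ T : ℕ, T₀ ≤ T →
      1 ≤ numEpochs C T δ ∧ 1 ≤ epochQueries C T δ ∧
      numEpochs C T δ * epochQueries C T δ ≤ T ∧
      ∀ P : PassiveProcedure, IsOptimalPassive s R C P →
      ∀ (η : ℝ → ℝ) (t : ℝ), IsThreshold s R η t → RiskGrowth R η t k c →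
      ∀ x₀ ∈ Set.Icc 0 R,
        ENNReal.ofReal (1 - δ) ≤
          MeasureTheory.volume {ω : Fin (numEpochs C T δ) → Seed (epochQueries C T δ) |
            excessRisk η t (adaptiveLearner R η C P T δ x₀ ω) ≤
              K * Real.logb 2 T ^ p * (T : ℝ) ^ (-(k / (2 * k - 2)))} := by
  refine ⟨⟨ermFactor, erm s R, isConfidenceFactor_ermFactor, isOptimalPassive_erm hR hs⟩,
    fun C hC k c δ hk hc hδ => ?_⟩
  obtain ⟨D, hD⟩ := hC.exists_eventually_largeBudget hδ
  obtain ⟨T₀, hT₀⟩ := Filter.eventually_atTop.1 hD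
  refine ⟨(4 * R + 2 * (2 ^ k / c) ^ (1 / (k - 1))) * √D ^ (k / (k - 1)), 2, T₀, fun T hT => ?_⟩
  have hT := hT₀ T hT
  exact ⟨hT.numEpochs_pos, hT.epochQueries_pos, Nat.mul_div_le _ _,
    fun P hP η t hη hrisk x₀ hx₀ => hT.adaptiveLearner_rate hR hk hc hP hη hrisk hx₀⟩

open ActiveThreshold in
theorem theorem1 (R : ℝ) (hR : 0 < R) (s : ℝ) (hs : s = 1 ∨ s = -1) :
    -- optimal passive procedures exist
    (∃ (C : ℝ → ℝ) (P : PassiveProcedure), IsConfidenceFactor C ∧ IsOptimalPassive s R C P) ∧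
    -- with any of them as the black box, the adaptive learner attains the rate
    ∀ C : ℝ → ℝ, IsConfidenceFactor C →
    ∀ k μ M ε₀ δ : ℝ, 2 ≤ k → 0 < μ → μ < M → 0 < ε₀ → 0 < δ → δ < 1 →
    ∃ (K : ℝ) (p T₀ : ℕ), ∀ T : ℕ, T₀ ≤ T →
      1 ≤ numEpochs C T δ ∧ 1 ≤ epochQueries C T δ ∧
      numEpochs C T δ * epochQueries C T δ ≤ T ∧
      ∀ P : PassiveProcedure, IsOptimalPassive s R C P →
      ∀ (η : ℝ → ℝ) (t : ℝ), IsThreshold s R η t → TNC R η t k μ M ε₀ →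
      ∀ x₀ ∈ Set.Icc 0 R,
        ENNReal.ofReal (1 - δ) ≤
          MeasureTheory.volume {ω : Fin (numEpochs C T δ) → Seed (epochQueries C T δ) |
            excessRisk η t (adaptiveLearner R η C P T δ x₀ ω) ≤
              K * Real.logb 2 T ^ p * (T : ℝ) ^ (-(k / (2 * k - 2)))} := by
  refine (theorem1_general hR hs).imp_right fun hrate C hC k μ M ε₀ δ hk hμ _ hε hδ _ => ?_
  obtain ⟨K, p, T₀, hK⟩ := hrate C hC k (2 * min μ (ε₀ / R ^ (k - 1)) / k) δ hk (by positivity) hδ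
  exact ⟨K, p, T₀, fun T hT => (hK T hT).imp_right <| And.imp_right <| And.imp_right
    fun hlearn P hP η t hη hnoise =>
      hlearn P hP η t hη (hnoise.riskGrowth hη hR (by linarith) hε.le)⟩
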